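/- Let $\Omega=(0,2\pi)^3$ with periodic boundary conditions, and write $|\cdot|$ and $(\cdot,\cdot)$ for the norm and inner product of $L^2(\Omega)$. Let $H^1$ be the space of periodic $H^1$ functions on $\Omega$, and for $g\in L^2(\Omega)^3$ let $|g|_{H^{-1}}=\sup\{(g,v): v\in (H^1)^3,\ \int_\Omega v=0,\ |\nabla v|\le 1\}$. There is a constant $c_0$ such that $$|v|^2\le c_0|\nabla v|^2\quad(v\in H^1),\qquad |\nabla v|^2\le c_0|\Delta v|^2\quad(v\in H^2)\qquad(\ast)$$ for all periodic $v$ with $\int_\Omega v=0$. Moreover, there are constants $c_2,c_4>0$ such that the following holds for every $c_0$ satisfying $(\ast)$. Let $\nu>0$ and $k>0$. Let $f(t)\in L^2(\Omega)^3$, $t\ge0$, satisfy $\nabla\cdot f(t)=0$, $\int_\Omega f(t)=0$ and $|f|_{L^\infty(L^2)}:=\sup_{t\ge0}|f(t)|<\infty$; put $|f|_{L^\infty(H^{-1})}:=\sup_{t\ge0}|f(t)|_{H^{-1}}$ and $f^n:=f(nk)$. Let $u^0\in (H^1)^3$ with $\nabla\cdot u^0=0$ and $\int_\Omega u^0=0$,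 and let $u^n\in (H^1)^3$, $n\ge1$, with $\nabla\cdot u^n=0$, solve (weakly, that is, when tested with smooth periodic divergence-free vector fields) the semi-implicit Euler scheme for the Navier–Stokes equations $$\frac{u^n-u^{n-1}}{k}+u^{n-1}\cdot\nabla u^n+\nabla p^n=\nu\Delta u^n+f^n,\qquad n\ge1 .$$ Put $$K_0=|u^0|^2+\frac{c_0}{\nu^2}|f|^2_{L^\infty(H^{-1})},\qquad K_1=|\nabla u^0|^2+\frac{2c_0}{\nu^2}|f|^2_{L^\infty(L^2)},\qquad F=\Bigl(\frac{\nu^2|f|^2_{L^\infty(L^2)}}{c_4}\Bigr)^{1/3}.$$ (Small data.) If $$\Bigl(K_0+\frac{k}{\nu}|f|^2_{L^\infty(H^{-1})}\Bigr)\Bigl(K_1+\frac{2k}{\nu}|f|^2_{L^\infty(L^2)}\Bigr)\le c_2\nu^4,$$ then $$|\nabla u^n|^2\le K_1+\frac{2k}{\nu}|f|^2_{L^\infty(L^2)}\qquad\text{for all } n\ge0 .$$ (Short times.) If $$k\le\frac{\nu^3}{2c_4\,(2|\nabla u^0|^2+F)^2},$$ then $$|\nabla u^n|^2\le 2|\nabla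 u^0|^2+F\qquad\text{for all } n\ge0 \text{ with } nk\le\frac{\nu^3}{8c_4\,(|\nabla u^0|^2+F)^2}.$$ (If $|\nabla u^0|^2+F=0$, both upper bounds on times are read as $+\infty$.) -/

import Mathlib

open MeasureTheory Set

noncomputable section

namespace PeriodicNS

/-- Points of `ℝ³`. -/
abbrev Pt : Type := Fin 3 → ℝ

/-- Vector fields, written through their three components. All fields are used only through
their values almost everywhere on the periodicity cell. -/
abbrev VField : Type := Fin 3 → Pt → ℝ

/-- Tensor fields; for a gradient, the entry `i j` is the partial derivative of the component `i`
in the direction `j`. -/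
abbrev TField : Type := Fin 3 → Fin 3 → Pt → ℝ

/-- The periodicity cell `(0, 2π)³`. -/
def cell : Set Pt := Set.univ.pi fun _ => Ioo (0 : ℝ) (2 * Real.pi)

/-- The integral over the cell. -/
def cellInt (g : Pt → ℝ) : ℝ := ∫ x in cell, g x

/-- The real-valued functions in `L²` of the cell. -/
def IsL2 (g : Pt → ℝ) : Prop := MemLp g 2 (volume.restrict cell)

/-- The classical partial derivative in the direction `j`. -/
def pd (j : Fin 3) (φ : Pt → ℝ) (x : Pt) : ℝ := fderiv ℝ φ x (Pi.single j 1)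

/-- Smooth functions on `ℝ³` that are `2π`-periodic in each variable. -/
structure IsPeriodicSmooth (φ : Pt → ℝ) : Prop where
  smooth : ContDiff ℝ (⊤ : ℕ∞) φ
  periodic : ∀ (i : Fin 3) (x : Pt), φ (x + Pi.single i (2 * Real.pi)) = φ x

/-- `v` belongs to the periodic Sobolev space `H¹` of the cell and `Dv` is its weak gradient.
Testing with all smooth periodic functions (and not only with those supported inside the cell)
encodes the periodic boundary condition. -/
structure IsH1 (v : Pt → ℝ) (Dv : Fin 3 → Pt → ℝ) : Prop where
  memL2 : IsL2 v
  grad_memL2 : ∀ j, IsL2 (Dv j)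
  weak : ∀ (j : Fin 3) (φ : Pt → ℝ), IsPeriodicSmooth φ →
    cellInt (fun x => v x * pd j φ x) = - cellInt (fun x => Dv j x * φ x)

/-- The `L²` inner product of vector fields. -/
def l2Inner (v w : VField) : ℝ := ∑ i, cellInt (fun x => v i x * w i x)

/-- `|v|²`, the squared `L²` norm of a vector field. -/
def l2Sq (v : VField) : ℝ := ∑ i, cellInt (fun x => (v i x) ^ 2)

/-- `|A|²`, the squared `L²` norm of a tensor field. -/
def tensorSq (A : TField) : ℝ := ∑ i, ∑ j, cellInt (fun x => (A i j x) ^ 2)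

/-- All components have vanishing integral. -/
def HasZeroMean (v : VField) : Prop := ∀ i, cellInt (v i) = 0

/-- The (periodic) distributional divergence vanishes. -/
def IsDivFree (v : VField) : Prop :=
  ∀ φ : Pt → ℝ, IsPeriodicSmooth φ → ∑ i, cellInt (fun x => v i x * pd i φ x) = 0

/-- `c₀` is an admissible constant in both inequalities `|v|² ≤ c₀ |∇v|²` (`v ∈ H¹`) and
`|∇v|² ≤ c₀ |Δv|²` (`v ∈ H²`), for periodic functions with vanishing integral. -/
structure IsPoincareConstant (c₀ : ℝ) : Prop where
  first : ∀ (v : Pt → ℝ) (Dv : Fin 3 → Pt → ℝ), IsH1 v Dv → cellInt v = 0 →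
    cellInt (fun x => (v x) ^ 2) ≤ c₀ * ∑ j, cellInt (fun x => (Dv j x) ^ 2)
  second : ∀ (v : Pt → ℝ) (Dv : Fin 3 → Pt → ℝ) (D2v : Fin 3 → Fin 3 → Pt → ℝ),
    IsH1 v Dv → cellInt v = 0 → (∀ j, IsH1 (Dv j) (D2v j)) →
    ∑ j, cellInt (fun x => (Dv j x) ^ 2) ≤ c₀ * cellInt (fun x => (∑ j, D2v j j x) ^ 2)

/-- The `H⁻¹` norm of an `L²` vector field: the norm dual to `|∇v|` on the periodic `H¹` vector
fields with vanishing integral. -/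
def hMinusOneNorm (g : VField) : ℝ :=
  sSup {r : ℝ | ∃ (v : VField) (Dv : TField), (∀ i, IsH1 (v i) (Dv i)) ∧ HasZeroMean v ∧
    tensorSq Dv ≤ 1 ∧ r = l2Inner g v}

/-- Forcings: bounded functions of time `t ≥ 0` with values in the divergence-free `L²` vector
fields with vanishing integral. -/
structure IsForcing (f : ℝ → VField) : Prop where
  memL2 : ∀ t, 0 ≤ t → ∀ i, IsL2 (f t i)
  zeroMean : ∀ t, 0 ≤ t → HasZeroMean (f t)
  divFree : ∀ t, 0 ≤ t → IsDivFree (f t)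
  bounded : BddAbove (Set.range fun t : Ici (0 : ℝ) => Real.sqrt (l2Sq (f t)))

/-- The supremum over `t ≥ 0` of the `L²` norm of `f t`. -/
def supL2 (f : ℝ → VField) : ℝ := ⨆ t : Ici (0 : ℝ), Real.sqrt (l2Sq (f t))

/-- The supremum over `t ≥ 0` of the `H⁻¹` norm of `f t`. -/
def supHMinusOne (f : ℝ → VField) : ℝ := ⨆ t : Ici (0 : ℝ), hMinusOneNorm (f t)

/-- One step `w ↦ u` of the semi-implicit Euler scheme
`(u - w)/k + w·∇u + ∇p = ν Δu + g`, in weak form: tested with the smooth periodic divergence-free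
vector fields, which removes the pressure gradient. `Du` is the weak gradient of `u`. -/
def IsEulerStep (ν k : ℝ) (g w u : VField) (Du : TField) : Prop :=
  ∀ φ : VField, (∀ i, IsPeriodicSmooth (φ i)) → (∀ x, ∑ i, pd i (φ i) x = 0) →
    ∑ i, cellInt (fun x => (u i x - w i x) / k * φ i x)
      + ∑ i, ∑ j, cellInt (fun x => w j x * Du i j x * φ i x)
      + ν * ∑ i, ∑ j, cellInt (fun x => Du i j x * pd j (φ i) x)
      = l2Inner g φ

/-- `u` is a solution of the semi-implicit Euler scheme with viscosity `ν`, timestep `k` and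
forcing `f n = f (n k)`, and `Du n` is the weak gradient of `u n`. -/
structure IsSemiImplicitSolution (ν k : ℝ) (f : ℝ → VField) (u : ℕ → VField) (Du : ℕ → TField) :
    Prop where
  memH1 : ∀ n i, IsH1 (u n i) (Du n i)
  divFree : ∀ n, IsDivFree (u n)
  zeroMean_init : HasZeroMean (u 0)
  step : ∀ n : ℕ, IsEulerStep ν k (f (((n + 1 : ℕ) : ℝ) * k)) (u n) (u (n + 1)) (Du (n + 1))

/-- `K₀ = |u₀|² + (c₀/ν²) |f|²`, with the `L^∞(H⁻¹)` norm of `f`. -/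
def K0 (c₀ ν : ℝ) (u₀ : VField) (f : ℝ → VField) : ℝ :=
  l2Sq u₀ + c₀ / ν ^ 2 * supHMinusOne f ^ 2

/-- `K₁ = |∇u₀|² + (2c₀/ν²) |f|²`, with the `L^∞(L²)` norm of `f`. -/
def K1 (c₀ ν : ℝ) (Du₀ : TField) (f : ℝ → VField) : ℝ :=
  tensorSq Du₀ + 2 * c₀ / ν ^ 2 * supL2 f ^ 2

/-- `F = (ν² |f|² / c₄)^(1/3)`, with the `L^∞(L²)` norm of `f`. -/
def Fconst (c₄ ν : ℝ) (f : ℝ → VField) : ℝ :=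
  (ν ^ 2 * supL2 f ^ 2 / c₄) ^ (1 / 3 : ℝ)

end PeriodicNS

end

open PeriodicNS

namespace PeriodicNS

open Filter Topology

/-! Each step of the scheme is linear in the new field `u`, with the old field `w` as a fixed
divergence-free drift. Testing formally with `u` removes the transport term and gives an energy
bound damped by Poincaré. Testing with `Δu` gives `|∇u|² + νk|Δu|² ≤ |∇w|² + 2k|T| + (k/ν)|g|²`,
with `T = (w·∇u, Δu)`, and everything depends on two bounds of `T`, both from the embedding of `H¹`
into `L⁶` by Hölder: `|T| ≤ C |w|^(1/2) |∇w|^(1/2) |Δu|²` and `|T| ≤ C |∇w| |∇u|^(1/2) |Δu|^(3/2)`,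
with `C² = 59319`. For small data the first bound lets the viscosity absorb `T`. Half of the
dissipation is left, and by Poincaré it yields a damped linear recurrence for `|∇u|²`
(`tensorSq_step_le_of_small`). In general, Young's inequality applied to the second bound gives the
recurrence `x' ≤ x + a x² x' + a F³` with `a = c₄k/ν³` (`tensorSq_step_le`), which is controlled for
short times by `le_of_quadratic_recurrence`.

The difficulty is that `u` is only in `H¹`, so that `Δu` is not an admissible test field. Regularity
theory is avoided by a Galerkin method (`exists_smooth_approximation`): on solenoidal trigonometric
polynomials the step has a solution, this space is stable under the Laplacian, and quasi-optimality
makes the Galerkin solutions converge to `u` in `H¹`. Both estimates hold for the approximations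
with constants independent of the space. Once `|Δφ|²` has been discarded or bounded below by
`|∇φ|²`, only `|φ|` and `|∇φ|` remain, and these pass to the limit.

The analytic tools are the `L²` convergence of Fourier series, carried over from the unit torus
(`tendsto_partialSum`), the Poincaré inequalities with constant 1 read off from Parseval, and the
`L⁶` embedding obtained from a Gagliardo–Loomis–Whitney inequality on the cell. -/

/-! ### Square integrable functions on the cell -/

theorem measurableSet_cell : MeasurableSet cell :=
  MeasurableSet.univ_pi fun _ => measurableSet_Ioo

theorem cell_subset_Icc : cell ⊆ Icc (0 : Pt) (fun _ => 2 * Real.pi) := fun _ hx =>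
  ⟨fun i => (hx i (mem_univ i)).1.le, fun i => (hx i (mem_univ i)).2.le⟩

theorem volume_cell_lt_top : volume cell < ⊤ :=
  (measure_mono cell_subset_Icc).trans_lt isCompact_Icc.measure_lt_top

instance isFiniteMeasure_cell : IsFiniteMeasure (volume.restrict cell) :=
  ⟨by simpa using volume_cell_lt_top⟩

theorem exists_bound_of_continuous {φ : Pt → ℝ} (hφ : Continuous φ) :
    ∃ M, 0 ≤ M ∧ ∀ x ∈ cell, |φ x| ≤ M := by
  obtain ⟨M, hM⟩ := (isCompact_Icc (a := (0 : Pt)) (b := fun _ => 2 * Real.pi)).exists_bound_of_continuousOn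
    hφ.continuousOn
  exact ⟨|M|, abs_nonneg _, fun x hx => (hM x (cell_subset_Icc hx)).trans (le_abs_self _)⟩

theorem memLp_of_continuous {φ : Pt → ℝ} (hφ : Continuous φ) (p : ENNReal) :
    MemLp φ p (volume.restrict cell) := by
  obtain ⟨M, -, hM⟩ := exists_bound_of_continuous hφ
  exact MemLp.of_bound hφ.aestronglyMeasurable M
    ((ae_restrict_iff' measurableSet_cell).2 (Eventually.of_forall hM))

theorem isL2_of_continuous {φ : Pt → ℝ} (hφ : Continuous φ) : IsL2 φ := memLp_of_continuous hφ 2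

theorem integrable_of_continuous {φ : Pt → ℝ} (hφ : Continuous φ) :
    Integrable φ (volume.restrict cell) := memLp_one_iff_integrable.1 (memLp_of_continuous hφ 1)

namespace IsL2

variable {v w φ : Pt → ℝ}

theorem integrable (hv : IsL2 v) : Integrable v (volume.restrict cell) :=
  MemLp.integrable one_le_two hv

theorem integrable_mul (hv : IsL2 v) (hw : IsL2 w) :
    Integrable (fun x => v x * w x) (volume.restrict cell) := MemLp.integrable_mul hv hw

theorem integrable_sq' (hv : IsL2 v) : Integrable (fun x => v x ^ 2) (volume.restrict cell) :=
  MemLp.integrable_sq hv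

theorem sub (hv : IsL2 v) (hw : IsL2 w) : IsL2 (fun x => v x - w x) := MemLp.sub hv hw

theorem mul_continuous (hv : IsL2 v) (hφ : Continuous φ) : IsL2 (fun x => v x * φ x) :=
  MemLp.mul (p := 2) (q := ⊤) (r := 2) (memLp_of_continuous hφ ⊤) hv

theorem sum {ι : Type*} (s : Finset ι) {f : ι → Pt → ℝ} (hf : ∀ i ∈ s, IsL2 (f i)) :
    IsL2 (fun x => ∑ i ∈ s, f i x) := memLp_finsetSum s hf

end IsL2

section CellInt

variable {g h : Pt → ℝ}

theorem cellInt_add (hg : Integrable g (volume.restrict cell))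
    (hh : Integrable h (volume.restrict cell)) :
    cellInt (fun x => g x + h x) = cellInt g + cellInt h := integral_add hg hh

theorem cellInt_sub (hg : Integrable g (volume.restrict cell))
    (hh : Integrable h (volume.restrict cell)) :
    cellInt (fun x => g x - h x) = cellInt g - cellInt h := integral_sub hg hh

theorem cellInt_const_mul (c : ℝ) (g : Pt → ℝ) :
    cellInt (fun x => c * g x) = c * cellInt g := integral_const_mul c g

theorem cellInt_neg (g : Pt → ℝ) : cellInt (fun x => - g x) = - cellInt g := integral_neg g

theorem cellInt_sum {ι : Type*} (s : Finset ι) {f : ι → Pt → ℝ}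
    (hf : ∀ i ∈ s, Integrable (f i) (volume.restrict cell)) :
    cellInt (fun x => ∑ i ∈ s, f i x) = ∑ i ∈ s, cellInt (f i) := integral_finsetSum s hf

theorem cellInt_nonneg (hg : ∀ x, 0 ≤ g x) : 0 ≤ cellInt g := integral_nonneg hg

theorem cellInt_mono_cell (hg : Integrable g (volume.restrict cell))
    (hh : Integrable h (volume.restrict cell)) (hgh : ∀ x ∈ cell, g x ≤ h x) :
    cellInt g ≤ cellInt h := setIntegral_mono_on hg hh measurableSet_cell hgh

theorem cellInt_congr (hgh : ∀ x, g x = h x) : cellInt g = cellInt h := by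
  rw [funext hgh]

end CellInt

/-- The squared `L²` norm of a finite family of functions. -/
noncomputable def normSq {ι : Type*} [Fintype ι] (v : ι → Pt → ℝ) : ℝ := ∑ i, cellInt (fun x => v i x ^ 2)

section NormSq

variable {ι : Type*} [Fintype ι]

theorem normSq_nonneg (v : ι → Pt → ℝ) : 0 ≤ normSq v :=
  Finset.sum_nonneg fun _ _ => cellInt_nonneg fun _ => sq_nonneg _

/-- Kept for every `t`: nonnegativity of this quadratic gives Cauchy–Schwarz through its
discriminant, and `t = 1`, `t = -1` give the parallelogram identity. -/
theorem normSq_add_mul (v w : ι → Pt → ℝ) (hv : ∀ i, IsL2 (v i)) (hw : ∀ i, IsL2 (w i)) (t : ℝ) :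
    normSq (fun i x => v i x + t * w i x)
      = normSq v + 2 * t * ∑ i, cellInt (fun x => v i x * w i x) + t ^ 2 * normSq w := by
  simp only [normSq, Finset.mul_sum, ← Finset.sum_add_distrib]
  refine Finset.sum_congr rfl fun i _ => ?_
  rw [← cellInt_const_mul, ← cellInt_const_mul, ← cellInt_add (hv i).integrable_sq'
    (((hv i).integrable_mul (hw i)).const_mul _), ← cellInt_add _ ((hw i).integrable_sq'.const_mul _)]
  · exact cellInt_congr fun x => by ring
  · exact (hv i).integrable_sq'.add (((hv i).integrable_mul (hw i)).const_mul _)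

theorem normSq_sub (v w : ι → Pt → ℝ) (hv : ∀ i, IsL2 (v i)) (hw : ∀ i, IsL2 (w i)) :
    normSq (fun i x => v i x - w i x)
      = normSq v - 2 * ∑ i, cellInt (fun x => v i x * w i x) + normSq w := by
  have h := normSq_add_mul v w hv hw (-1)
  calc _ = _ := by congr 1; ext i x; ring
    _ = _ := h
    _ = _ := by ring

/-- The Cauchy-Schwarz inequality for finite families of functions. -/
theorem sum_cellInt_mul_sq_le (v w : ι → Pt → ℝ) (hv : ∀ i, IsL2 (v i)) (hw : ∀ i, IsL2 (w i)) :
    (∑ i, cellInt (fun x => v i x * w i x)) ^ 2 ≤ normSq v * normSq w := by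
  have h := discrim_le_zero (a := normSq w) (b := 2 * ∑ i, cellInt (fun x => v i x * w i x))
    (c := normSq v) fun t => by
      have := normSq_nonneg (fun i x => v i x + t * w i x)
      rw [normSq_add_mul v w hv hw] at this
      linarith
  simp only [discrim] at h
  nlinarith

theorem abs_sum_cellInt_mul_le (v w : ι → Pt → ℝ) (hv : ∀ i, IsL2 (v i)) (hw : ∀ i, IsL2 (w i)) :
    |∑ i, cellInt (fun x => v i x * w i x)| ≤ √(normSq v) * √(normSq w) := by
  rw [← Real.sqrt_mul (normSq_nonneg v)]
  exact Real.abs_le_sqrt (sum_cellInt_mul_sq_le v w hv hw)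

theorem cellInt_mul_sq_le {v w : Pt → ℝ} (hv : IsL2 v) (hw : IsL2 w) :
    cellInt (fun x => v x * w x) ^ 2
      ≤ cellInt (fun x => v x ^ 2) * cellInt (fun x => w x ^ 2) := by
  simpa [normSq] using sum_cellInt_mul_sq_le (ι := Unit) (fun _ => v) (fun _ => w)
    (fun _ => hv) (fun _ => hw)

theorem normSq_add_le (v w : ι → Pt → ℝ) (hv : ∀ i, IsL2 (v i)) (hw : ∀ i, IsL2 (w i)) :
    normSq (fun i x => v i x + w i x) ≤ 2 * normSq v + 2 * normSq w := by
  have h1 := normSq_add_mul v w hv hw 1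
  have h2 := normSq_add_mul v w hv hw (-1)
  have h3 := normSq_nonneg (fun i x => v i x + (-1) * w i x)
  simp only [one_mul] at h1
  linarith

theorem tendsto_sum_cellInt_mul {α : Type*} {l : Filter α} {F : α → ι → Pt → ℝ} {G w : ι → Pt → ℝ}
    (hF : ∀ a i, IsL2 (F a i)) (hG : ∀ i, IsL2 (G i)) (hw : ∀ i, IsL2 (w i))
    (h : Tendsto (fun a => normSq (fun i x => F a i x - G i x)) l (𝓝 0)) :
    Tendsto (fun a => ∑ i, cellInt (fun x => F a i x * w i x)) l
      (𝓝 (∑ i, cellInt (fun x => G i x * w i x))) := by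
  rw [tendsto_iff_dist_tendsto_zero]
  have h0 : Tendsto (fun a => √(normSq (fun i x => F a i x - G i x)) * √(normSq w)) l (𝓝 0) := by
    simpa using (h.sqrt).mul_const (√(normSq w))
  refine squeeze_zero (fun _ => dist_nonneg) (fun a => ?_) h0
  rw [Real.dist_eq]
  refine le_trans (le_of_eq ?_)
    (abs_sum_cellInt_mul_le _ _ (fun i => (hF a i).sub (hG i)) hw)
  rw [← Finset.sum_sub_distrib]
  congr 1
  refine Finset.sum_congr rfl fun i _ => ?_
  rw [← cellInt_sub ((hF a i).integrable_mul (hw i)) ((hG i).integrable_mul (hw i))]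
  exact cellInt_congr fun x => by ring

theorem tendsto_normSq {α : Type*} {l : Filter α} {F : α → ι → Pt → ℝ} {G : ι → Pt → ℝ}
    (hF : ∀ a i, IsL2 (F a i)) (hG : ∀ i, IsL2 (G i))
    (h : Tendsto (fun a => normSq (fun i x => F a i x - G i x)) l (𝓝 0)) :
    Tendsto (fun a => normSq (F a)) l (𝓝 (normSq G)) := by
  have h1 := tendsto_sum_cellInt_mul hF hG hG h
  have h2 : Tendsto (fun a => normSq (fun i x => F a i x - G i x)
      + 2 * ∑ i, cellInt (fun x => F a i x * G i x) - normSq G) l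
      (𝓝 (0 + 2 * ∑ i, cellInt (fun x => G i x * G i x) - normSq G)) :=
    (h.add (h1.const_mul 2)).sub_const _
  convert h2 using 2 with a
  · rw [normSq_sub _ _ (hF a) hG]; ring
  · simp only [normSq, ← pow_two]; ring

end NormSq

theorem tendsto_cellInt_mul {α : Type*} {l : Filter α} {F : α → Pt → ℝ} {G w : Pt → ℝ}
    (hF : ∀ a, IsL2 (F a)) (hG : IsL2 G) (hw : IsL2 w)
    (h : Tendsto (fun a => cellInt (fun x => (F a x - G x) ^ 2)) l (𝓝 0)) :
    Tendsto (fun a => cellInt (fun x => F a x * w x)) l (𝓝 (cellInt (fun x => G x * w x))) := by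
  simpa [normSq] using tendsto_sum_cellInt_mul (ι := Unit) (F := fun a _ => F a) (G := fun _ => G)
    (w := fun _ => w) (fun a _ => hF a) (fun _ => hG) (fun _ => hw) (by simpa [normSq] using h)

theorem tendsto_cellInt_sq {α : Type*} {l : Filter α} {F : α → Pt → ℝ} {G : Pt → ℝ}
    (hF : ∀ a, IsL2 (F a)) (hG : IsL2 G)
    (h : Tendsto (fun a => cellInt (fun x => (F a x - G x) ^ 2)) l (𝓝 0)) :
    Tendsto (fun a => cellInt (fun x => F a x ^ 2)) l (𝓝 (cellInt (fun x => G x ^ 2))) := by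
  simpa [normSq] using tendsto_normSq (ι := Unit) (F := fun a _ => F a) (G := fun _ => G)
    (fun a _ => hF a) (fun _ => hG) (by simpa [normSq] using h)

/-- A continuous function is bounded on the cell, so multiplication by it is a bounded operator on
`L²`. -/
theorem tendsto_cellInt_sub_mul_sq {α : Type*} {l : Filter α} {F : α → Pt → ℝ} {G φ : Pt → ℝ}
    (hF : ∀ a, IsL2 (F a)) (hG : IsL2 G) (hφ : Continuous φ)
    (h : Tendsto (fun a => cellInt (fun x => (F a x - G x) ^ 2)) l (𝓝 0)) :
    Tendsto (fun a => cellInt (fun x => (F a x * φ x - G x * φ x) ^ 2)) l (𝓝 0) := by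
  obtain ⟨M, hM0, hM⟩ := exists_bound_of_continuous hφ
  refine squeeze_zero (fun _ => cellInt_nonneg fun _ => sq_nonneg _) (fun a => ?_)
    (by simpa using h.const_mul (M ^ 2))
  rw [← cellInt_const_mul]
  refine cellInt_mono_cell (((hF a).mul_continuous hφ).sub (hG.mul_continuous hφ)).integrable_sq'
    (((hF a).sub hG).integrable_sq'.const_mul _) fun x hx => ?_
  have : φ x ^ 2 ≤ M ^ 2 := sq_le_sq.2 ((hM x hx).trans (le_abs_self M))
  nlinarith [sq_nonneg (F a x - G x)]

theorem tensorSq_eq_normSq (A : TField) :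
    tensorSq A = normSq (fun p : Fin 3 × Fin 3 => A p.1 p.2) := by
  simp only [tensorSq, normSq, Fintype.sum_prod_type]

theorem tensorSq_eq_sum_normSq (A : TField) : tensorSq A = ∑ i, normSq (A i) := rfl

theorem l2Sq_nonneg (v : VField) : 0 ≤ l2Sq v := normSq_nonneg v

theorem tensorSq_nonneg (A : TField) : 0 ≤ tensorSq A := by
  rw [tensorSq_eq_normSq]; exact normSq_nonneg _

/-! ### Classical derivatives and integration by parts for periodic functions -/

section Derivative

variable {φ ψ : Pt → ℝ} {j : Fin 3} {x : Pt}

theorem pd_add (hφ : DifferentiableAt ℝ φ x) (hψ : DifferentiableAt ℝ ψ x) :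
    pd j (fun y => φ y + ψ y) x = pd j φ x + pd j ψ x := by
  simp [pd, fderiv_fun_add hφ hψ]

theorem pd_mul (hφ : DifferentiableAt ℝ φ x) (hψ : DifferentiableAt ℝ ψ x) :
    pd j (fun y => φ y * ψ y) x = φ x * pd j ψ x + pd j φ x * ψ x := by
  simp [pd, fderiv_fun_mul hφ hψ]; ring

theorem pd_const_mul (hφ : DifferentiableAt ℝ φ x) (c : ℝ) :
    pd j (fun y => c * φ y) x = c * pd j φ x := by
  simp [pd, fderiv_const_mul hφ]

theorem pd_const (c : ℝ) : pd j (fun _ => c) x = 0 := by simp [pd]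

theorem pd_pow (hφ : DifferentiableAt ℝ φ x) (n : ℕ) :
    pd j (fun y => φ y ^ n) x = n * φ x ^ (n - 1) * pd j φ x := by
  simp [pd, fderiv_fun_pow n hφ]

theorem pd_sum {ι : Type*} (s : Finset ι) {f : ι → Pt → ℝ}
    (hf : ∀ i ∈ s, DifferentiableAt ℝ (f i) x) :
    pd j (fun y => ∑ i ∈ s, f i y) x = ∑ i ∈ s, pd j (f i) x := by
  simp [pd, fderiv_fun_sum hf]

theorem pd_comm (hφ : ContDiff ℝ (⊤ : ℕ∞) φ) (i j : Fin 3) (x : Pt) :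
    pd i (pd j φ) x = pd j (pd i φ) x := by
  have h2 : DifferentiableAt ℝ (fderiv ℝ φ) x :=
    ((hφ.fderiv_right (m := 1) (by norm_cast)).differentiable (by norm_num)).differentiableAt
  have h (a b : Fin 3) : pd a (pd b φ) x
      = fderiv ℝ (fderiv ℝ φ) x (Pi.single a 1) (Pi.single b 1) := by
    change fderiv ℝ (fun y => fderiv ℝ φ y (Pi.single b 1)) x (Pi.single a 1) = _
    rw [fderiv_clm_apply h2 (differentiableAt_const _)]
    simp
  rw [h, h]
  exact (hφ.contDiffAt.isSymmSndFDerivAt (by simp; norm_cast)).eq _ _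

end Derivative

namespace IsPeriodicSmooth

variable {φ ψ : Pt → ℝ}

theorem continuous (hφ : IsPeriodicSmooth φ) : Continuous φ := hφ.smooth.continuous

theorem differentiableAt (hφ : IsPeriodicSmooth φ) (x : Pt) : DifferentiableAt ℝ φ x :=
  (hφ.smooth.differentiable (by simp)).differentiableAt

theorem isL2 (hφ : IsPeriodicSmooth φ) : IsL2 φ := isL2_of_continuous hφ.continuous

theorem integrable (hφ : IsPeriodicSmooth φ) : Integrable φ (volume.restrict cell) :=
  integrable_of_continuous hφ.continuous

theorem const (c : ℝ) : IsPeriodicSmooth (fun _ => c) := ⟨contDiff_const, fun _ _ => rfl⟩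

theorem add (hφ : IsPeriodicSmooth φ) (hψ : IsPeriodicSmooth ψ) :
    IsPeriodicSmooth (fun x => φ x + ψ x) :=
  ⟨hφ.smooth.add hψ.smooth, fun i x => by simp only [hφ.periodic, hψ.periodic]⟩

theorem mul (hφ : IsPeriodicSmooth φ) (hψ : IsPeriodicSmooth ψ) :
    IsPeriodicSmooth (fun x => φ x * ψ x) :=
  ⟨hφ.smooth.mul hψ.smooth, fun i x => by simp only [hφ.periodic, hψ.periodic]⟩

theorem const_mul (hφ : IsPeriodicSmooth φ) (c : ℝ) : IsPeriodicSmooth (fun x => c * φ x) :=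
  (const c).mul hφ

theorem pow (hφ : IsPeriodicSmooth φ) (n : ℕ) : IsPeriodicSmooth (fun x => φ x ^ n) :=
  ⟨hφ.smooth.pow n, fun i x => by simp only [hφ.periodic]⟩

theorem sum {ι : Type*} (s : Finset ι) {f : ι → Pt → ℝ} (hf : ∀ i ∈ s, IsPeriodicSmooth (f i)) :
    IsPeriodicSmooth (fun x => ∑ i ∈ s, f i x) :=
  ⟨ContDiff.sum fun i hi => (hf i hi).smooth,
    fun i x => Finset.sum_congr rfl fun a ha => (hf a ha).periodic i x⟩

theorem pd (hφ : IsPeriodicSmooth φ) (j : Fin 3) : IsPeriodicSmooth (pd j φ) := by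
  refine ⟨(hφ.smooth.fderiv_right (m := (⊤ : ℕ∞)) (by norm_cast)).clm_apply contDiff_const,
    fun i x => ?_⟩
  have h := fderiv_comp_add_right (𝕜 := ℝ) (f := φ) (x := x) (Pi.single i (2 * Real.pi))
  simp only [hφ.periodic] at h
  simp only [PeriodicNS.pd]
  rw [← h]

end IsPeriodicSmooth

theorem cellInt_eq_Icc (g : Pt → ℝ) :
    cellInt g = ∫ x in Icc (0 : Pt) (fun _ => 2 * Real.pi), g x :=
  setIntegral_congr_set (Measure.univ_pi_Ioo_ae_eq_Icc (f := (0 : Pt)) (g := fun _ => 2 * Real.pi))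

theorem cellInt_pd {φ : Pt → ℝ} (hφ : IsPeriodicSmooth φ) (j : Fin 3) : cellInt (pd j φ) = 0 := by
  -- The divergence theorem on the closed box, for the vector field whose only nonzero component is
  -- `φ` in the direction `j`.
  have h := integral_divergence_of_hasFDerivAt_off_countable' (n := 2) (E := ℝ) (0 : Pt)
    (fun _ => 2 * Real.pi) (fun i => by simpa using Real.pi_pos.le)
    (fun i x => if i = j then φ x else 0) (fun i x => if i = j then fderiv ℝ φ x else 0)
    ∅ countable_empty (fun i => by
      split_ifs
      · exact hφ.continuous.continuousOn
      · exact continuousOn_const) (fun x _ i => by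
      split_ifs
      · exact (hφ.differentiableAt x).hasFDerivAt
      · exact hasFDerivAt_const _ _) (by
      have : (fun x : Pt => ∑ i, (if i = j then fderiv ℝ φ x else 0) (Pi.single i 1)) = pd j φ := by
        ext x
        rw [Finset.sum_eq_single j] <;> simp +contextual [pd]
      rw [this]
      exact (hφ.pd j).continuous.continuousOn.integrableOn_compact isCompact_Icc)
  have h1 : ∀ x : Pt, ∑ i, (if i = j then fderiv ℝ φ x else 0) (Pi.single i 1) = pd j φ x := by
    intro x
    rw [Finset.sum_eq_single j] <;> simp +contextual [pd]
  simp only [h1] at h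
  rw [cellInt_eq_Icc, h]
  refine Finset.sum_eq_zero fun i _ => sub_eq_zero.2 ?_
  refine setIntegral_congr_fun measurableSet_Icc fun x _ => ?_
  -- Opposite faces are translates of each other by a period, so their contributions cancel.
  have : (i.insertNth (2 * Real.pi) x : Pt)
      = (i.insertNth 0 x : Pt) + Pi.single i (2 * Real.pi) := by
    ext m
    refine Fin.succAboveCases i ?_ (fun m => ?_) m <;> simp
  simp only [Pi.zero_apply, this, hφ.periodic]

theorem cellInt_mul_pd {φ ψ : Pt → ℝ} (hφ : IsPeriodicSmooth φ) (hψ : IsPeriodicSmooth ψ)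
    (j : Fin 3) :
    cellInt (fun x => φ x * pd j ψ x) = - cellInt (fun x => pd j φ x * ψ x) := by
  have h := cellInt_pd (hφ.mul hψ) j
  have h1 : pd j (fun x => φ x * ψ x) = fun x => φ x * pd j ψ x + pd j φ x * ψ x :=
    funext fun x => pd_mul (hφ.differentiableAt x) (hψ.differentiableAt x)
  rw [h1, cellInt_add (hφ.mul (hψ.pd j)).integrable ((hφ.pd j).mul hψ).integrable] at h
  linarith

theorem IsPeriodicSmooth.isH1 {φ : Pt → ℝ} (hφ : IsPeriodicSmooth φ) :
    IsH1 φ (fun j => PeriodicNS.pd j φ) :=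
  ⟨hφ.isL2, fun j => (hφ.pd j).isL2, fun j _ hψ => cellInt_mul_pd hφ hψ j⟩

/-! ### Fourier series on the cell -/

section Torus

attribute [local instance] instMeasureSpaceUnitAddCircle

/-- Turns convergence of classes in `Lp` into convergence of the integral of a concrete function, by
writing the squared norm as an inner product and choosing representatives. -/
theorem tendsto_mFourier_L2 {d : Type*} [Fintype d] (G : UnitAddTorus d → ℂ)
    (hG : MemLp G 2 volume) :
    Tendsto (fun S : Finset (d → ℤ) => ∫ y, ‖∑ k ∈ S,
      UnitAddTorus.mFourierCoeff G k * UnitAddTorus.mFourier k y - G y‖ ^ 2) atTop (𝓝 0) := by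
  have h := UnitAddTorus.hasSum_mFourier_series_L2 (hG.toLp G)
  have hc : ∀ k, UnitAddTorus.mFourierCoeff (hG.toLp G) k = UnitAddTorus.mFourierCoeff G k :=
    fun k => integral_congr_ae (by filter_upwards [hG.coeFn_toLp] with y hy; rw [hy])
  simp only [hc] at h
  have h1 := (tendsto_iff_norm_sub_tendsto_zero.1 h).pow 2
  rw [zero_pow two_ne_zero] at h1
  refine h1.congr fun S => ?_
  rw [← inner_self_eq_norm_sq (𝕜 := ℂ), L2.inner_def]
  have h2 : (∫ y, inner ℂ ((∑ k ∈ S, UnitAddTorus.mFourierCoeff G k • UnitAddTorus.mFourierLp 2 k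
      - hG.toLp G : Lp ℂ 2 volume) y) ((∑ k ∈ S, UnitAddTorus.mFourierCoeff G k •
        UnitAddTorus.mFourierLp 2 k - hG.toLp G : Lp ℂ 2 volume) y))
      = ((∫ y, ‖∑ k ∈ S, UnitAddTorus.mFourierCoeff G k * UnitAddTorus.mFourier k y - G y‖ ^ 2 : ℝ) : ℂ) := by
    refine Eq.trans (integral_congr_ae ?_) (integral_ofReal (𝕜 := ℂ))
    have h3 : ∀ k ∈ S, (UnitAddTorus.mFourierCoeff G k • UnitAddTorus.mFourierLp 2 k : Lp ℂ 2 volume)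
        =ᵐ[volume] fun y => UnitAddTorus.mFourierCoeff G k * UnitAddTorus.mFourier k y := fun k _ => by
      filter_upwards [Lp.coeFn_smul (UnitAddTorus.mFourierCoeff G k)
        (UnitAddTorus.mFourierLp 2 k), UnitAddTorus.coeFn_mFourierLp 2 k] with y h4 h5
      rw [h4, Pi.smul_apply, h5, smul_eq_mul]
    filter_upwards [Lp.coeFn_sub (∑ k ∈ S, UnitAddTorus.mFourierCoeff G k •
      UnitAddTorus.mFourierLp 2 k) (hG.toLp G), hG.coeFn_toLp,
      Lp.coeFn_finsetSum S (fun k => UnitAddTorus.mFourierCoeff G k • UnitAddTorus.mFourierLp 2 k),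
      (S.eventually_all).2 h3] with y h4 h5 h6 h7
    rw [h4, Pi.sub_apply, h5, h6, Finset.sum_apply, Finset.sum_congr rfl h7, inner_self_eq_norm_sq_to_K]
    norm_cast
  rw [h2]
  simp

end Torus

/-- The phase `k · x` of the Fourier mode with wave vector `k`. -/
def phase (k : Fin 3 → ℤ) (x : Pt) : ℝ := ∑ i, (k i : ℝ) * x i

/-- The cosine Fourier coefficient. -/
noncomputable def cosCoeff (v : Pt → ℝ) (k : Fin 3 → ℤ) : ℝ :=
  cellInt (fun x => v x * Real.cos (phase k x))

/-- The sine Fourier coefficient. -/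
noncomputable def sinCoeff (v : Pt → ℝ) (k : Fin 3 → ℤ) : ℝ :=
  cellInt (fun x => v x * Real.sin (phase k x))

/-- The partial sum of the Fourier series over a finite set of wave vectors. -/
noncomputable def partialSum (S : Finset (Fin 3 → ℤ)) (v : Pt → ℝ) (x : Pt) : ℝ :=
  ((2 * Real.pi) ^ 3)⁻¹ * ∑ k ∈ S, (cosCoeff v k * Real.cos (phase k x)
    + sinCoeff v k * Real.sin (phase k x))

theorem continuous_phase (k : Fin 3 → ℤ) : Continuous (phase k) := by
  unfold phase; fun_prop

/-- The dilation maps the half-open unit cube onto the half-open cell, which differs from the open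
one by a null set; the factor is the inverse Jacobian. -/
theorem map_smul_restrict_unitCube :
    Measure.map (fun x : Pt => (2 * Real.pi) • x)
      (volume.restrict {x : Pt | ∀ i, x i ∈ Ioc ((0 : Pt) i) ((0 : Pt) i + 1)})
      = ENNReal.ofReal ((2 * Real.pi) ^ 3)⁻¹ • volume.restrict cell := by
  have hpos : 0 < 2 * Real.pi := by positivity
  have hcell : volume.restrict cell
      = volume.restrict (Set.univ.pi fun _ : Fin 3 => Ioc (0 : ℝ) (2 * Real.pi)) :=
    Measure.restrict_congr_set
      ((Measure.univ_pi_Ioo_ae_eq_Icc (f := fun _ : Fin 3 => (0 : ℝ))).trans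
        Measure.univ_pi_Ioc_ae_eq_Icc.symm)
  have hpre : {x : Pt | ∀ i, x i ∈ Ioc ((0 : Pt) i) ((0 : Pt) i + 1)}
      = (fun x : Pt => (2 * Real.pi) • x) ⁻¹' (Set.univ.pi fun _ : Fin 3 => Ioc (0 : ℝ) (2 * Real.pi)) := by
    ext x
    simp only [mem_ofPred_eq, mem_preimage, mem_univ_pi, mem_Ioc, Pi.zero_apply, zero_add,
      Pi.smul_apply, smul_eq_mul]
    refine forall_congr' fun i => and_congr ?_ ?_
    · exact (mul_pos_iff_of_pos_left hpos).symm
    · exact (mul_le_iff_le_one_right hpos).symm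
  rw [hcell, hpre, ← Measure.restrict_map (measurable_const_smul _)
    (MeasurableSet.univ_pi fun _ => measurableSet_Ioc), Measure.map_addHaar_smul _ hpos.ne',
    Measure.restrict_smul]
  congr 2
  rw [abs_of_pos (by positivity)]
  simp

theorem integral_unitCube_smul {E : Type*} [NormedAddCommGroup E] [NormedSpace ℝ E] (h : Pt → E) :
    ∫ x in {x : Pt | ∀ i, x i ∈ Ioc ((0 : Pt) i) ((0 : Pt) i + 1)}, h ((2 * Real.pi) • x)
      = ((2 * Real.pi) ^ 3)⁻¹ • ∫ x in cell, h x := by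
  have hpos : 2 * Real.pi ≠ 0 := by positivity
  have he : MeasurableEmbedding (fun x : Pt => (2 * Real.pi) • x) :=
    (Homeomorph.smulOfNeZero _ hpos).measurableEmbedding
  rw [← he.integral_map (μ := volume.restrict _) h, map_smul_restrict_unitCube,
    integral_smul_measure, ENNReal.toReal_ofReal (by positivity)]

section Torus

attribute [local instance] instMeasureSpaceUnitAddCircle

open UnitAddTorus

/-- The torus function reads `v` through a fundamental domain and a dilation, so pointwise
periodicity of `v` plays no role. -/
theorem memLp_torus {v : Pt → ℝ} (hv : IsL2 v) :
    MemLp (fun y : UnitAddTorus (Fin 3) =>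
      (v ((2 * Real.pi) • (measurableEquivPiIoc (0 : Pt) y).1) : ℂ)) 2 volume := by
  have hs : MeasurableSet {x : Pt | ∀ i, x i ∈ Ioc ((0 : Pt) i) ((0 : Pt) i + 1)} :=
    MeasurableSet.univ_pi' fun i => measurableSet_Ioc
  have h1 : MemLp (fun x : Pt => (v ((2 * Real.pi) • x) : ℂ)) 2
      (volume.restrict {x : Pt | ∀ i, x i ∈ Ioc ((0 : Pt) i) ((0 : Pt) i + 1)}) := by
    have h2 : MemLp v 2 (Measure.map (fun x : Pt => (2 * Real.pi) • x)
      (volume.restrict {x : Pt | ∀ i, x i ∈ Ioc ((0 : Pt) i) ((0 : Pt) i + 1)})) := by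
      rw [map_smul_restrict_unitCube]
      exact MemLp.smul_measure hv ENNReal.ofReal_ne_top
    exact (h2.comp_of_map (measurable_const_smul _).aemeasurable).ofReal
  rw [← map_comap_subtype_coe hs] at h1
  exact (h1.comp_of_map measurable_subtype_coe.aemeasurable).comp_measurePreserving
    (measurePreserving_equivPiIoc 0)

theorem mFourier_coe_eq (k : Fin 3 → ℤ) (x : Pt) :
    mFourier k (fun i => (x i : UnitAddCircle))
      = Complex.exp (phase k ((2 * Real.pi) • x) * Complex.I) := by
  simp only [mFourier, ContinuousMap.coe_mk, fourier_coe_apply, ← Complex.exp_sum]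
  congr 1
  simp only [phase, Pi.smul_apply, smul_eq_mul]
  push_cast
  rw [Finset.sum_mul]
  refine Finset.sum_congr rfl fun i _ => by ring

theorem integral_torus_eq {E : Type*} [NormedAddCommGroup E] [NormedSpace ℝ E]
    (f : UnitAddTorus (Fin 3) → E) (h : Pt → E)
    (hfh : ∀ x ∈ {x : Pt | ∀ i, x i ∈ Ioc ((0 : Pt) i) ((0 : Pt) i + 1)},
      f (fun i => (x i : UnitAddCircle)) = h ((2 * Real.pi) • x)) :
    ∫ y, f y = ((2 * Real.pi) ^ 3)⁻¹ • ∫ x in cell, h x := by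
  rw [integral_preimage _ (0 : Pt), ← integral_unitCube_smul h]
  exact setIntegral_congr_fun (MeasurableSet.univ_pi' fun i => measurableSet_Ioc) hfh

theorem measurableEquivPiIoc_coe {x : Pt} (hx : ∀ i, x i ∈ Ioc ((0 : Pt) i) ((0 : Pt) i + 1)) :
    (measurableEquivPiIoc (0 : Pt) (fun i => (x i : UnitAddCircle))).1 = x :=
  congrArg Subtype.val ((measurableEquivPiIoc (0 : Pt)).apply_symm_apply ⟨x, hx⟩)

theorem mFourierCoeff_torus {v : Pt → ℝ} (hv : IsL2 v) (k : Fin 3 → ℤ) :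
    mFourierCoeff (fun y : UnitAddTorus (Fin 3) =>
      (v ((2 * Real.pi) • (measurableEquivPiIoc (0 : Pt) y).1) : ℂ)) k
      = ((2 * Real.pi : ℂ) ^ 3)⁻¹ * (cosCoeff v k - sinCoeff v k * Complex.I) := by
  rw [mFourierCoeff, integral_torus_eq _ (fun z : Pt => ((v z * Real.cos (phase k z) : ℝ) : ℂ)
          - ((v z * Real.sin (phase k z) : ℝ) : ℂ) * Complex.I) fun x hx => ?_]
  · have hc : Integrable (fun x => v x * Real.cos (phase k x)) (volume.restrict cell) :=
      (hv.mul_continuous (Real.continuous_cos.comp (continuous_phase k))).integrable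
    have hs : Integrable (fun x => v x * Real.sin (phase k x)) (volume.restrict cell) :=
      (hv.mul_continuous (Real.continuous_sin.comp (continuous_phase k))).integrable
    rw [integral_sub hc.ofReal (hs.ofReal.mul_const _), integral_mul_const,
      integral_complex_ofReal, integral_complex_ofReal]
    simp only [cosCoeff, sinCoeff, cellInt, Complex.real_smul]
    push_cast
    rfl
  · simp only [measurableEquivPiIoc_coe hx, mFourier_neg, mFourier_coe_eq, Complex.exp_mul_I,
      ← Complex.ofReal_cos, ← Complex.ofReal_sin, map_add, map_mul, Complex.conj_ofReal,
      Complex.conj_I, smul_eq_mul]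
    push_cast
    ring

theorem partialSum_isL2 (S : Finset (Fin 3 → ℤ)) (v : Pt → ℝ) : IsL2 (partialSum S v) := by
  refine isL2_of_continuous ?_
  unfold partialSum
  have := continuous_phase
  fun_prop

/-- The Fourier series of a function in `L²` converges to it in `L²`. -/
theorem tendsto_partialSum {v : Pt → ℝ} (hv : IsL2 v) :
    Tendsto (fun S => cellInt (fun x => (partialSum S v x - v x) ^ 2)) atTop (𝓝 0) := by
  have h := (tendsto_mFourier_L2 _ (memLp_torus hv)).const_mul ((2 * Real.pi) ^ 3)
  rw [mul_zero] at h
  refine squeeze_zero (fun _ => cellInt_nonneg fun _ => sq_nonneg _) (fun S => ?_) h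
  simp only [mFourierCoeff_torus hv]
  rw [integral_torus_eq _ (fun z : Pt => ‖∑ k ∈ S, ((2 * Real.pi : ℂ) ^ 3)⁻¹ *
    (cosCoeff v k - sinCoeff v k * Complex.I) * Complex.exp (phase k z * Complex.I)
      - (v z : ℂ)‖ ^ 2) fun x hx => by simp only [measurableEquivPiIoc_coe hx, mFourier_coe_eq],
    smul_eq_mul, mul_inv_cancel_left₀ (by positivity)]
  -- The real partial sum is the real part of the complex one. As `v` is real, its error is at most
  -- the complex error, and `S` need not be symmetric under `k ↦ -k`.
  have hre : ∀ z, partialSum S v z - v z = (∑ k ∈ S, ((2 * Real.pi : ℂ) ^ 3)⁻¹ *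
      (cosCoeff v k - sinCoeff v k * Complex.I)
        * Complex.exp (phase k z * Complex.I) - (v z : ℂ)).re := fun z => by
    rw [Complex.sub_re, Complex.ofReal_re, Complex.re_sum, partialSum, Finset.mul_sum]
    congr 1
    refine Finset.sum_congr rfl fun k _ => ?_
    have h3 : ((2 * Real.pi : ℂ) ^ 3)⁻¹ = ((((2 * Real.pi) ^ 3)⁻¹ : ℝ) : ℂ) := by push_cast; rfl
    rw [h3, Complex.exp_mul_I, ← Complex.ofReal_cos, ← Complex.ofReal_sin, mul_assoc,
      Complex.re_ofReal_mul]
    congr 1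
    simp [-Complex.ofReal_cos, -Complex.ofReal_sin]
  have hc : Continuous fun z => ∑ k ∈ S, ((2 * Real.pi : ℂ) ^ 3)⁻¹ *
      (cosCoeff v k - sinCoeff v k * Complex.I) * Complex.exp (phase k z * Complex.I) := by
    have := continuous_phase
    fun_prop
  refine integral_mono ((partialSum_isL2 S v).sub hv).integrable_sq' ?_ fun z => ?_
  · have h4 : MemLp (fun z => ∑ k ∈ S, ((2 * Real.pi : ℂ) ^ 3)⁻¹ *
      (cosCoeff v k - sinCoeff v k * Complex.I) * Complex.exp (phase k z * Complex.I)) 2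
      (volume.restrict cell) := by
      obtain ⟨M, hM⟩ := (isCompact_Icc (a := (0 : Pt))
        (b := fun _ => 2 * Real.pi)).exists_bound_of_continuousOn hc.continuousOn
      exact MemLp.of_bound hc.aestronglyMeasurable M ((ae_restrict_iff' measurableSet_cell).2
        (Eventually.of_forall fun x hx => hM x (cell_subset_Icc hx)))
    exact (h4.sub (MemLp.ofReal hv)).integrable_norm_pow (p := 2) (by norm_num)
  · simp only [hre]
    rw [← sq_abs]
    exact pow_le_pow_left₀ (abs_nonneg _) (Complex.abs_re_le_norm _) 2

end Torus

theorem phase_add_period (k : Fin 3 → ℤ) (i : Fin 3) (x : Pt) :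
    phase k (x + Pi.single i (2 * Real.pi)) = phase k x + k i * (2 * Real.pi) := by
  simp [phase, mul_add, Finset.sum_add_distrib, Pi.single_apply]

theorem hasFDerivAt_phase (k : Fin 3 → ℤ) (x : Pt) :
    HasFDerivAt (phase k) (∑ i, (k i : ℝ) • ContinuousLinearMap.proj (R := ℝ) (φ := fun _ => ℝ) i) x := by
  unfold phase
  exact HasFDerivAt.fun_sum fun i _ => (hasFDerivAt_apply i x).const_mul _

theorem pd_phase (k : Fin 3 → ℤ) (j : Fin 3) (x : Pt) : pd j (phase k) x = k j := by
  simp [pd, (hasFDerivAt_phase k x).fderiv, Pi.single_apply]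

theorem isPeriodicSmooth_cos_phase (k : Fin 3 → ℤ) :
    IsPeriodicSmooth (fun x => Real.cos (phase k x)) := by
  refine ⟨?_, fun i x => ?_⟩
  · unfold phase; fun_prop
  · simp only [phase_add_period, Real.cos_add_int_mul_two_pi]

theorem isPeriodicSmooth_sin_phase (k : Fin 3 → ℤ) :
    IsPeriodicSmooth (fun x => Real.sin (phase k x)) := by
  refine ⟨?_, fun i x => ?_⟩
  · unfold phase; fun_prop
  · simp only [phase_add_period, Real.sin_add_int_mul_two_pi]

theorem pd_cos_phase (k : Fin 3 → ℤ) (j : Fin 3) (x : Pt) :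
    pd j (fun y => Real.cos (phase k y)) x = - (k j * Real.sin (phase k x)) := by
  rw [pd, fderiv_cos (hasFDerivAt_phase k x).differentiableAt]
  have := pd_phase k j x
  rw [pd] at this
  simp [this, mul_comm]

theorem pd_sin_phase (k : Fin 3 → ℤ) (j : Fin 3) (x : Pt) :
    pd j (fun y => Real.sin (phase k y)) x = k j * Real.cos (phase k x) := by
  rw [pd, fderiv_sin (hasFDerivAt_phase k x).differentiableAt]
  have := pd_phase k j x
  rw [pd] at this
  simp [this, mul_comm]

theorem isPeriodicSmooth_partialSum (S : Finset (Fin 3 → ℤ)) (v : Pt → ℝ) :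
    IsPeriodicSmooth (partialSum S v) :=
  (IsPeriodicSmooth.sum S fun k _ => ((isPeriodicSmooth_cos_phase k).const_mul (cosCoeff v k)).add
    ((isPeriodicSmooth_sin_phase k).const_mul (sinCoeff v k))).const_mul _

theorem pd_partialSum (S : Finset (Fin 3 → ℤ)) (v : Pt → ℝ) (j : Fin 3) (x : Pt) :
    pd j (partialSum S v) x = ((2 * Real.pi) ^ 3)⁻¹ * ∑ k ∈ S,
      ((k j * sinCoeff v k) * Real.cos (phase k x) - (k j * cosCoeff v k) * Real.sin (phase k x)) := by
  have hc := isPeriodicSmooth_cos_phase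
  have hs := isPeriodicSmooth_sin_phase
  unfold partialSum
  rw [pd_const_mul, pd_sum]
  · congr 1
    refine Finset.sum_congr rfl fun k _ => ?_
    rw [pd_add (((hc k).const_mul _).differentiableAt x) (((hs k).const_mul _).differentiableAt x),
      pd_const_mul ((hc k).differentiableAt x), pd_const_mul ((hs k).differentiableAt x),
      pd_cos_phase, pd_sin_phase]
    ring
  · exact fun k _ => (((hc k).const_mul _).add ((hs k).const_mul _)).differentiableAt x
  · exact (IsPeriodicSmooth.sum S fun k _ => ((hc k).const_mul (cosCoeff v k)).add
      ((hs k).const_mul (sinCoeff v k))).differentiableAt x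

theorem IsH1.cosCoeff_grad {v : Pt → ℝ} {Dv : Fin 3 → Pt → ℝ} (h : IsH1 v Dv) (j : Fin 3)
    (k : Fin 3 → ℤ) : cosCoeff (Dv j) k = k j * sinCoeff v k := by
  have := h.weak j _ (isPeriodicSmooth_cos_phase k)
  simp only [pd_cos_phase] at this
  rw [cosCoeff, ← neg_eq_iff_eq_neg.2 this, ← cellInt_neg, sinCoeff, ← cellInt_const_mul]
  exact cellInt_congr fun x => by ring

theorem IsH1.sinCoeff_grad {v : Pt → ℝ} {Dv : Fin 3 → Pt → ℝ} (h : IsH1 v Dv) (j : Fin 3)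
    (k : Fin 3 → ℤ) : sinCoeff (Dv j) k = - (k j * cosCoeff v k) := by
  have := h.weak j _ (isPeriodicSmooth_sin_phase k)
  simp only [pd_sin_phase] at this
  rw [sinCoeff, ← neg_eq_iff_eq_neg.2 this, cosCoeff, ← cellInt_const_mul]
  congr 1
  exact cellInt_congr fun x => by ring

/-- Truncation commutes with differentiation, so `L²` convergence of Fourier series is automatically
`H¹` convergence. -/
theorem IsH1.pd_partialSum_eq {v : Pt → ℝ} {Dv : Fin 3 → Pt → ℝ} (h : IsH1 v Dv)
    (S : Finset (Fin 3 → ℤ)) (j : Fin 3) : pd j (partialSum S v) = partialSum S (Dv j) := by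
  ext x
  rw [pd_partialSum, partialSum]
  simp only [h.cosCoeff_grad, h.sinCoeff_grad]
  congr 1
  exact Finset.sum_congr rfl fun k _ => by ring

/-- Testing the divergence condition with single modes shows that the coefficient vectors are
orthogonal to `k`, so each mode is solenoidal by itself. -/
theorem sum_pd_partialSum_eq_zero {u : VField} (hu : IsDivFree u)
    (S : Finset (Fin 3 → ℤ)) (x : Pt) : ∑ i, pd i (partialSum S (u i)) x = 0 := by
  have h1 : ∀ k : Fin 3 → ℤ, ∑ i, (k i : ℝ) * cosCoeff (u i) k = 0 := fun k => by
    have := hu _ (isPeriodicSmooth_sin_phase k)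
    simp only [pd_sin_phase] at this
    rw [← this]
    refine Finset.sum_congr rfl fun i _ => ?_
    rw [cosCoeff, ← cellInt_const_mul]
    exact cellInt_congr fun x => by ring
  have h2 : ∀ k : Fin 3 → ℤ, ∑ i, (k i : ℝ) * sinCoeff (u i) k = 0 := fun k => by
    have := hu _ (isPeriodicSmooth_cos_phase k)
    simp only [pd_cos_phase] at this
    rw [← neg_zero, ← this, ← Finset.sum_neg_distrib]
    refine Finset.sum_congr rfl fun i _ => ?_
    rw [sinCoeff, ← cellInt_const_mul, ← cellInt_neg]
    exact cellInt_congr fun x => by ring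
  simp only [pd_partialSum, ← Finset.mul_sum]
  rw [Finset.sum_comm]
  simp only [Finset.sum_sub_distrib, ← Finset.sum_mul, h1, h2]
  simp

theorem cellInt_sin_phase (k : Fin 3 → ℤ) : cellInt (fun x => Real.sin (phase k x)) = 0 := by
  by_cases hk : k = 0
  · simp [hk, phase, cellInt]
  · obtain ⟨j, hj⟩ := Function.ne_iff.1 hk
    have := cellInt_pd (isPeriodicSmooth_cos_phase k) j
    rw [funext (pd_cos_phase k j), cellInt_neg, cellInt_const_mul] at this
    simpa [show k j ≠ 0 from hj] using this

theorem cellInt_cos_phase {k : Fin 3 → ℤ} (hk : k ≠ 0) :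
    cellInt (fun x => Real.cos (phase k x)) = 0 := by
  obtain ⟨j, hj⟩ := Function.ne_iff.1 hk
  have := cellInt_pd (isPeriodicSmooth_sin_phase k) j
  rw [funext (pd_sin_phase k j), cellInt_const_mul] at this
  simpa [show k j ≠ 0 from hj] using this

theorem cosCoeff_zero (v : Pt → ℝ) : cosCoeff v 0 = cellInt v := by
  simp [cosCoeff, phase]

theorem sinCoeff_zero (v : Pt → ℝ) : sinCoeff v 0 = 0 := by
  simp [sinCoeff, phase, cellInt]

theorem cellInt_partialSum_mul (S : Finset (Fin 3 → ℤ)) (v : Pt → ℝ) {w : Pt → ℝ} (hw : IsL2 w) :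
    cellInt (fun x => partialSum S v x * w x) = ((2 * Real.pi) ^ 3)⁻¹ * ∑ k ∈ S,
      (cosCoeff v k * cosCoeff w k + sinCoeff v k * sinCoeff w k) := by
  have hc : ∀ k, Integrable (fun x => w x * Real.cos (phase k x)) (volume.restrict cell) :=
    fun k => (hw.mul_continuous (isPeriodicSmooth_cos_phase k).continuous).integrable
  have hs : ∀ k, Integrable (fun x => w x * Real.sin (phase k x)) (volume.restrict cell) :=
    fun k => (hw.mul_continuous (isPeriodicSmooth_sin_phase k).continuous).integrable
  have h1 : ∀ x, partialSum S v x * w x = ((2 * Real.pi) ^ 3)⁻¹ * ∑ k ∈ S,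
      (cosCoeff v k * (w x * Real.cos (phase k x)) + sinCoeff v k * (w x * Real.sin (phase k x))) := by
    intro x
    rw [partialSum, mul_assoc, Finset.sum_mul]
    congr 1
    exact Finset.sum_congr rfl fun k _ => by ring
  rw [cellInt_congr h1, cellInt_const_mul, cellInt_sum]
  · congr 1
    refine Finset.sum_congr rfl fun k _ => ?_
    rw [cellInt_add ((hc k).const_mul _) ((hs k).const_mul _), cellInt_const_mul,
      cellInt_const_mul]
    rfl
  · exact fun k _ => ((hc k).const_mul _).add ((hs k).const_mul _)

theorem cellInt_partialSum {v : Pt → ℝ} (hv : cellInt v = 0) (S : Finset (Fin 3 → ℤ)) :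
    cellInt (partialSum S v) = 0 := by
  have h := cellInt_partialSum_mul S v (isL2_of_continuous (continuous_const (y := (1 : ℝ))))
  simp only [mul_one] at h
  rw [show cellInt (partialSum S v) = cellInt (fun x => partialSum S v x) from rfl, h]
  refine mul_eq_zero_of_right _ (Finset.sum_eq_zero fun k _ => ?_)
  have h1 : sinCoeff (fun _ => (1 : ℝ)) k = 0 := by
    simpa [sinCoeff] using cellInt_sin_phase k
  by_cases hk : k = 0
  · simp [hk, cosCoeff_zero, sinCoeff_zero, hv]
  · have h2 : cosCoeff (fun _ => (1 : ℝ)) k = 0 := by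
      simpa [cosCoeff] using cellInt_cos_phase hk
    simp [h1, h2]

/-- The convergence of the partial sums is tested with `v` itself. -/
theorem tendsto_parseval {v : Pt → ℝ} (hv : IsL2 v) :
    Tendsto (fun S => ((2 * Real.pi) ^ 3)⁻¹ * ∑ k ∈ S, (cosCoeff v k ^ 2 + sinCoeff v k ^ 2)) atTop
      (𝓝 (cellInt (fun x => v x ^ 2))) := by
  have h := tendsto_cellInt_mul (fun S => partialSum_isL2 S v) hv hv (tendsto_partialSum hv)
  simp only [cellInt_partialSum_mul _ v hv, ← pow_two] at h
  exact h

/-! ### Poincaré inequalities -/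

/-- Wave vectors are integral: this spectral gap is what makes 1 a Poincaré constant. -/
theorem one_le_sum_sq {k : Fin 3 → ℤ} (hk : k ≠ 0) : (1 : ℝ) ≤ ∑ j, (k j : ℝ) ^ 2 := by
  obtain ⟨j, hj⟩ := Function.ne_iff.1 hk
  have h1 : (1 : ℝ) ≤ (k j : ℝ) ^ 2 := by
    have : (1 : ℤ) ≤ (k j) ^ 2 := by
      have := Int.one_le_abs hj
      rw [← sq_abs]; nlinarith
    exact_mod_cast this
  exact h1.trans (Finset.single_le_sum (f := fun j => (k j : ℝ) ^ 2)
    (fun _ _ => sq_nonneg _) (Finset.mem_univ j))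

/-- The Poincaré inequality on the cell with the constant `1`. -/
theorem IsH1.poincare {v : Pt → ℝ} {Dv : Fin 3 → Pt → ℝ} (h : IsH1 v Dv) (hv : cellInt v = 0) :
    cellInt (fun x => v x ^ 2) ≤ ∑ j, cellInt (fun x => Dv j x ^ 2) := by
  refine le_of_tendsto_of_tendsto' (tendsto_parseval h.memL2)
    (tendsto_finsetSum _ fun j _ => tendsto_parseval (h.grad_memL2 j)) fun S => ?_
  rw [← Finset.mul_sum, Finset.sum_comm]
  refine mul_le_mul_of_nonneg_left (Finset.sum_le_sum fun k _ => ?_) (by positivity)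
  have h1 : ∑ j, (cosCoeff (Dv j) k ^ 2 + sinCoeff (Dv j) k ^ 2)
      = (∑ j, (k j : ℝ) ^ 2) * (cosCoeff v k ^ 2 + sinCoeff v k ^ 2) := by
    rw [Finset.sum_mul]
    refine Finset.sum_congr rfl fun j _ => ?_
    rw [h.cosCoeff_grad, h.sinCoeff_grad]
    ring
  rw [h1]
  by_cases hk : k = 0
  · simp [hk, cosCoeff_zero, sinCoeff_zero, hv]
  · exact le_mul_of_one_le_left (by positivity) (one_le_sum_sq hk)

theorem cosCoeff_sum {ι : Type*} (s : Finset ι) {f : ι → Pt → ℝ} (hf : ∀ i ∈ s, IsL2 (f i))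
    (k : Fin 3 → ℤ) : cosCoeff (fun x => ∑ i ∈ s, f i x) k = ∑ i ∈ s, cosCoeff (f i) k := by
  simp only [cosCoeff, Finset.sum_mul]
  exact cellInt_sum s fun i hi =>
    ((hf i hi).mul_continuous (isPeriodicSmooth_cos_phase k).continuous).integrable

theorem sinCoeff_sum {ι : Type*} (s : Finset ι) {f : ι → Pt → ℝ} (hf : ∀ i ∈ s, IsL2 (f i))
    (k : Fin 3 → ℤ) : sinCoeff (fun x => ∑ i ∈ s, f i x) k = ∑ i ∈ s, sinCoeff (f i) k := by
  simp only [sinCoeff, Finset.sum_mul]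
  exact cellInt_sum s fun i hi =>
    ((hf i hi).mul_continuous (isPeriodicSmooth_sin_phase k).continuous).integrable

/-- The second-order Poincaré inequality on the cell with the constant `1`. -/
theorem IsH1.poincare_laplacian {v : Pt → ℝ} {Dv : Fin 3 → Pt → ℝ} {D2v : Fin 3 → Fin 3 → Pt → ℝ}
    (h : IsH1 v Dv) (h2 : ∀ j, IsH1 (Dv j) (D2v j)) :
    ∑ j, cellInt (fun x => Dv j x ^ 2) ≤ cellInt (fun x => (∑ j, D2v j j x) ^ 2) := by
  have hL : ∀ j ∈ Finset.univ, IsL2 (D2v j j) := fun j _ => (h2 j).grad_memL2 j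
  refine le_of_tendsto_of_tendsto'
    (tendsto_finsetSum _ fun j _ => tendsto_parseval (h.grad_memL2 j))
    (tendsto_parseval (IsL2.sum _ hL)) fun S => ?_
  rw [← Finset.mul_sum, Finset.sum_comm]
  refine mul_le_mul_of_nonneg_left (Finset.sum_le_sum fun k _ => ?_) (by positivity)
  have h1 : ∑ j, (cosCoeff (Dv j) k ^ 2 + sinCoeff (Dv j) k ^ 2)
      = (∑ j, (k j : ℝ) ^ 2) * (cosCoeff v k ^ 2 + sinCoeff v k ^ 2) := by
    rw [Finset.sum_mul]
    refine Finset.sum_congr rfl fun j _ => ?_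
    rw [h.cosCoeff_grad, h.sinCoeff_grad]
    ring
  have h3 : cosCoeff (fun x => ∑ j, D2v j j x) k = - (∑ j, (k j : ℝ) ^ 2) * cosCoeff v k := by
    rw [cosCoeff_sum _ hL, ← Finset.sum_neg_distrib, Finset.sum_mul]
    refine Finset.sum_congr rfl fun j _ => ?_
    rw [(h2 j).cosCoeff_grad, h.sinCoeff_grad]
    ring
  have h4 : sinCoeff (fun x => ∑ j, D2v j j x) k = - (∑ j, (k j : ℝ) ^ 2) * sinCoeff v k := by
    rw [sinCoeff_sum _ hL, ← Finset.sum_neg_distrib, Finset.sum_mul]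
    refine Finset.sum_congr rfl fun j _ => ?_
    rw [(h2 j).sinCoeff_grad, h.cosCoeff_grad]
    ring
  rw [h1, h3, h4]
  have h5 : (- (∑ j, (k j : ℝ) ^ 2) * cosCoeff v k) ^ 2 + (- (∑ j, (k j : ℝ) ^ 2) * sinCoeff v k) ^ 2
      = (∑ j, (k j : ℝ) ^ 2) * ((∑ j, (k j : ℝ) ^ 2) * (cosCoeff v k ^ 2 + sinCoeff v k ^ 2)) := by
    ring
  rw [h5]
  by_cases hk : k = 0
  · simp [hk]
  · exact le_mul_of_one_le_left (by positivity) (one_le_sum_sq hk)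

theorem isPoincareConstant_one : IsPoincareConstant 1 where
  first v Dv h hv := by simpa using h.poincare hv
  second v Dv D2v h _ h2 := by simpa using h.poincare_laplacian h2

/-- A constant `c₀ ≤ 0` would make both the sine and the cosine of the first coordinate vanish in
`L²`, although their squares add up to 1. -/
theorem IsPoincareConstant.pos {c₀ : ℝ} (h : IsPoincareConstant c₀) : 0 < c₀ := by
  by_contra! hc
  have hk : (Pi.single 0 1 : Fin 3 → ℤ) ≠ 0 := by simp
  set k : Fin 3 → ℤ := Pi.single 0 1
  have h1 := h.first _ _ (isPeriodicSmooth_cos_phase k).isH1 (cellInt_cos_phase hk)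
  have h2 := h.first _ _ (isPeriodicSmooth_sin_phase k).isH1 (cellInt_sin_phase k)
  have h3 : 0 ≤ ∑ j, cellInt (fun x => pd j (fun y => Real.cos (phase k y)) x ^ 2) :=
    Finset.sum_nonneg fun _ _ => cellInt_nonneg fun _ => sq_nonneg _
  have h4 : 0 ≤ ∑ j, cellInt (fun x => pd j (fun y => Real.sin (phase k y)) x ^ 2) :=
    Finset.sum_nonneg fun _ _ => cellInt_nonneg fun _ => sq_nonneg _
  have h5 : cellInt (fun _ => 1) = cellInt (fun x => Real.cos (phase k x) ^ 2)
      + cellInt (fun x => Real.sin (phase k x) ^ 2) := by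
    rw [← cellInt_add ((isPeriodicSmooth_cos_phase k).pow 2).integrable
      ((isPeriodicSmooth_sin_phase k).pow 2).integrable]
    exact cellInt_congr fun x => (Real.cos_sq_add_sin_sq _).symm
  have h6 : 0 < cellInt (fun _ => 1) := by
    have : 0 < volume cell := by
      refine (isOpen_set_pi finite_univ fun _ _ => isOpen_Ioo).measure_pos _
        ⟨fun _ => Real.pi, fun _ _ => ⟨Real.pi_pos, ?_⟩⟩
      linarith [Real.pi_pos]
    simpa [cellInt, Measure.real] using ENNReal.toReal_pos this.ne' volume_cell_lt_top.ne
  nlinarith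

/-! ### Sobolev embedding and product estimates -/

/-- Average `|h s| ≤ |h t| + ∫ |h'|` over `t`; the length `L ≥ 1` allows dropping the factor `1/L`
of the first integral. -/
theorem abs_le_setIntegral_abs_add_abs_deriv {L : ℝ} (hL : 1 ≤ L) {h h' : ℝ → ℝ}
    (hd : ∀ t, HasDerivAt h (h' t) t) (hc : Continuous h') {s : ℝ} (hs : s ∈ Ioo 0 L) :
    |h s| ≤ ∫ t in Ioo 0 L, (|h t| + |h' t|) := by
  have hch : Continuous h := continuous_iff_continuousAt.2 fun t => (hd t).continuousAt
  have hi : ∀ {φ : ℝ → ℝ}, Continuous φ → IntegrableOn φ (Ioo 0 L) := fun hφ =>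
    (hφ.continuousOn.integrableOn_compact isCompact_Icc).mono_set Ioo_subset_Icc_self
  have h1 : ∀ t ∈ Ioo 0 L, |h s| ≤ |h t| + ∫ r in Ioo 0 L, |h' r| := fun t ht => by
    have h2 : ∫ r in t..s, h' r = h s - h t :=
      intervalIntegral.integral_eq_sub_of_hasDerivAt (fun r _ => hd r) (hc.intervalIntegrable _ _)
    have h3 : |h s - h t| ≤ ∫ r in Ioo 0 L, |h' r| := by
      rw [← h2]
      refine (intervalIntegral.norm_integral_le_integral_norm_uIoc (f := h') (a := t) (b := s)
        (μ := volume)).trans ?_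
      refine setIntegral_mono_set (hi hc.abs) (Eventually.of_forall fun _ => abs_nonneg _) ?_
      refine LE.le.eventuallyLE (fun r hr => ?_)
      rw [uIoc, mem_Ioc] at hr
      exact ⟨(lt_min ht.1 hs.1).trans hr.1, hr.2.trans_lt (max_lt ht.2 hs.2)⟩
    have := abs_sub_abs_le_abs_sub (h s) (h t)
    linarith
  have h4 : ∫ _ in Ioo 0 L, |h s| ≤ ∫ t in Ioo 0 L, (|h t| + ∫ r in Ioo 0 L, |h' r|) :=
    setIntegral_mono_on (hi (continuous_const (y := |h s|)))
    (hi (hch.abs.add continuous_const)) measurableSet_Ioo h1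
  rw [integral_add (hi hch.abs) (hi continuous_const)] at h4
  simp only [setIntegral_const, measureReal_def, Real.volume_Ioo, sub_zero, smul_eq_mul,
    ENNReal.toReal_ofReal (zero_le_one.trans hL)] at h4
  rw [integral_add (hi hch.abs) (hi hc.abs)]
  have h5 : 0 ≤ ∫ t in Ioo 0 L, |h t| := integral_nonneg fun _ => abs_nonneg _
  have hL0 : 0 < L := zero_lt_one.trans_le hL
  refine le_of_mul_le_mul_left (h4.trans ?_) hL0
  nlinarith

theorem restrict_cell_eq_pi : (volume.restrict cell : Measure Pt)
    = Measure.pi fun _ : Fin 3 => volume.restrict (Ioo (0 : ℝ) (2 * Real.pi)) := by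
  rw [cell, volume_pi, Measure.restrict_pi_pi]

theorem hasDerivAt_comp_update {g : Pt → ℝ} (hg : Differentiable ℝ g) (x : Pt) (i : Fin 3) (t : ℝ) :
    HasDerivAt (fun t => g (Function.update x i t)) (pd i g (Function.update x i t)) t := by
  have h1 := (hg (Function.update x i t)).hasFDerivAt.comp_hasDerivAt t
    (_root_.hasDerivAt_update x i t)
  exact h1

theorem continuous_pd {g : Pt → ℝ} (hg : ContDiff ℝ 1 g) (j : Fin 3) : Continuous (pd j g) :=
  (hg.continuous_fderiv (by norm_num)).clm_apply continuous_const

/-- The embedding of `W^{1,1}` of the cell into `L^{3/2}`. -/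
theorem lintegral_rpow_le_of_contDiff {g : Pt → ℝ} (hg : ContDiff ℝ 1 g) :
    ∫⁻ x in cell, ENNReal.ofReal |g x| ^ (3 / 2 : ℝ)
      ≤ (∫⁻ x in cell, ENNReal.ofReal (|g x| + ∑ j, |pd j g x|)) ^ (3 / 2 : ℝ) := by
  have hpd := continuous_pd hg
  have hgc := hg.continuous
  have hF : Continuous fun x => |g x| + ∑ j, |pd j g x| := by fun_prop
  have h := lintegral_prod_lintegral_pow_le
    (fun _ : Fin 3 => volume.restrict (Ioo (0 : ℝ) (2 * Real.pi))) (p := 3 / 2)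
    (by rw [Real.holderConjugate_iff]; norm_num) (f := fun x : Pt =>
      ENNReal.ofReal (|g x| + ∑ j, |pd j g x|)) (by fun_prop)
  rw [← restrict_cell_eq_pi] at h
  refine le_trans (setLIntegral_mono_ae' measurableSet_cell (Eventually.of_forall fun x hx => ?_)) h
  have h1 : ∀ i : Fin 3, ENNReal.ofReal |g x| ≤ ∫⁻ t in Ioo (0 : ℝ) (2 * Real.pi),
      ENNReal.ofReal (|g (Function.update x i t)| + ∑ j, |pd j g (Function.update x i t)|) := by
    intro i
    have hu : Continuous fun t : ℝ => Function.update x i t := continuous_const.update i continuous_id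
    have hint : IntegrableOn (fun t => |g (Function.update x i t)|
        + |pd i g (Function.update x i t)|) (Ioo (0 : ℝ) (2 * Real.pi)) := by
      refine (Continuous.continuousOn ?_).integrableOn_compact isCompact_Icc |>.mono_set
        Ioo_subset_Icc_self
      exact (hgc.comp hu).abs.add ((hpd i).comp hu).abs
    have h2 := abs_le_setIntegral_abs_add_abs_deriv (L := 2 * Real.pi)
      (by linarith [Real.pi_gt_three])
      (hasDerivAt_comp_update (hg.differentiable (by norm_num)) x i) ((hpd i).comp hu) (hx i (mem_univ i))
    simp only [Function.update_eq_self] at h2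
    refine (ENNReal.ofReal_le_ofReal h2).trans ?_
    rw [ofReal_integral_eq_lintegral_ofReal hint (Eventually.of_forall fun t => by positivity)]
    refine lintegral_mono fun t => ENNReal.ofReal_le_ofReal ?_
    gcongr
    exact Finset.single_le_sum (f := fun j => |pd j g (Function.update x i t)|)
      (fun _ _ => abs_nonneg _) (Finset.mem_univ i)
  -- Gagliardo's argument: `|g|^(3/2)` is a product of three factors `|g|^(1/2)`, and the factor `i`
  -- is bounded by an integral along the line in the direction `i`.
  calc ENNReal.ofReal |g x| ^ (3 / 2 : ℝ)
      = ∏ _i : Fin 3, ENNReal.ofReal |g x| ^ ((1 : ℝ) / (Fintype.card (Fin 3) - 1 : ℝ)) := by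
        rw [Finset.prod_const, Finset.card_univ, ← ENNReal.rpow_natCast, ← ENNReal.rpow_mul]
        norm_num
    _ ≤ _ := Finset.prod_le_prod' fun i _ => ENNReal.rpow_le_rpow (h1 i) (by norm_num)

/-- The embedding of `W^{1,1}` into `L^{3/2}` for `a⁴`, whose power `3/2` is `a⁶`. Squaring removes
the fractional exponent. -/
theorem cellInt_pow_six_sq_le {a : Pt → ℝ} (ha : IsPeriodicSmooth a) :
    cellInt (fun x => a x ^ 6) ^ 2
      ≤ cellInt (fun x => a x ^ 4 + ∑ j, 4 * |a x ^ 3 * pd j a x|) ^ 3 := by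
  have hpd := fun j => (ha.pd j).continuous
  have hac := ha.continuous
  have h := lintegral_rpow_le_of_contDiff ((ha.pow 4).smooth.of_le (by simp))
  have h1 : ∀ x, |a x ^ 4| + ∑ j, |pd j (fun y => a y ^ 4) x|
      = a x ^ 4 + ∑ j, 4 * |a x ^ 3 * pd j a x| := fun x => by
    rw [abs_of_nonneg (by positivity)]
    congr 1
    refine Finset.sum_congr rfl fun j _ => ?_
    rw [pd_pow (ha.differentiableAt x), abs_mul, abs_mul, abs_mul]
    norm_num [mul_assoc]
  have h2 : ∀ x, ENNReal.ofReal |a x ^ 4| ^ (3 / 2 : ℝ) = ENNReal.ofReal (a x ^ 6) := fun x => by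
    rw [ENNReal.ofReal_rpow_of_nonneg (abs_nonneg _) (by norm_num)]
    congr 1
    have h3 : |a x ^ 4| = |a x| ^ (4 : ℝ) := by rw [abs_pow]; norm_cast
    rw [h3, ← Real.rpow_mul (abs_nonneg _), show (4 : ℝ) * (3 / 2) = (6 : ℕ) by norm_num,
      Real.rpow_natCast, Even.pow_abs (by decide)]
  simp only [h1, h2] at h
  have hFc : Continuous fun x => a x ^ 4 + ∑ j, 4 * |a x ^ 3 * pd j a x| := by fun_prop
  have hF0 : ∀ x, 0 ≤ a x ^ 4 + ∑ j, 4 * |a x ^ 3 * pd j a x| := fun x => by positivity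
  have h60 : ∀ x, 0 ≤ a x ^ 6 := fun x => by positivity
  rw [← ofReal_integral_eq_lintegral_ofReal (ha.pow 6).integrable (Eventually.of_forall h60),
    ← ofReal_integral_eq_lintegral_ofReal (integrable_of_continuous hFc) (Eventually.of_forall hF0),
    ENNReal.ofReal_rpow_of_nonneg (integral_nonneg hF0) (by norm_num),
    ENNReal.ofReal_le_ofReal_iff (Real.rpow_nonneg (integral_nonneg hF0) _)] at h
  have h4 := pow_le_pow_left₀ (cellInt_nonneg h60) h 2
  refine h4.trans (le_of_eq ?_)
  rw [← Real.rpow_natCast, ← Real.rpow_mul (integral_nonneg hF0),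
    show (3 / 2 : ℝ) * (2 : ℕ) = (3 : ℕ) by norm_num, Real.rpow_natCast]
  rfl

/-- The embedding of `H¹` into `L⁶` for periodic functions with vanishing mean. -/
theorem cellInt_pow_six_le {a : Pt → ℝ} (ha : IsPeriodicSmooth a) (ha0 : cellInt a = 0) :
    cellInt (fun x => a x ^ 6) ≤ 169 ^ 3 * (∑ j, cellInt (fun x => pd j a x ^ 2)) ^ 3 := by
  set A := cellInt (fun x => a x ^ 6) with hA
  set D := ∑ j, cellInt (fun x => pd j a x ^ 2) with hD
  have hA0 : 0 ≤ A := cellInt_nonneg fun x => by positivity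
  have hDj : ∀ j, cellInt (fun x => pd j a x ^ 2) ≤ D := fun j =>
    Finset.single_le_sum (f := fun j => cellInt (fun x => pd j a x ^ 2))
      (fun _ _ => cellInt_nonneg fun _ => sq_nonneg _) (Finset.mem_univ j)
  have hD0 : 0 ≤ D := (cellInt_nonneg fun _ => sq_nonneg _).trans (hDj 0)
  have hcs : ∀ b : Pt → ℝ, Continuous b → cellInt (fun x => b x ^ 2) ≤ D →
      cellInt (fun x => |a x ^ 3 * b x|) ≤ √A * √D := fun b hb hbD => by
    have h := cellInt_mul_sq_le (isL2_of_continuous (ha.pow 3).continuous.abs)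
      (isL2_of_continuous hb.abs)
    simp only [← abs_mul, sq_abs, ← pow_mul] at h
    rw [← Real.sqrt_mul hA0]
    refine Real.le_sqrt_of_sq_le (h.trans ?_)
    exact mul_le_mul_of_nonneg_left hbD hA0
  have h1 : cellInt (fun x => a x ^ 4) ≤ √A * √D := by
    convert hcs a ha.continuous (ha.isH1.poincare ha0) using 2
    ext x
    rw [show a x ^ 3 * a x = a x ^ 4 by ring, abs_of_nonneg (by positivity)]
  have hint : ∀ j, Integrable (fun x => |a x ^ 3 * pd j a x|) (volume.restrict cell) := fun j =>
    integrable_of_continuous ((ha.pow 3).mul (ha.pd j)).continuous.abs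
  -- Here `13 = 1 + 3 · 4`: the quartic term, bounded through Poincaré, and one term for each of the
  -- three derivatives of `a⁴`.
  have h2 : cellInt (fun x => a x ^ 4 + ∑ j, 4 * |a x ^ 3 * pd j a x|) ≤ 13 * (√A * √D) := by
    rw [cellInt_add (ha.pow 4).integrable (integrable_finsetSum _ fun j _ => (hint j).const_mul 4),
      cellInt_sum _ fun j _ => (hint j).const_mul 4]
    simp only [cellInt_const_mul, Fin.sum_univ_three]
    have := fun j => hcs _ (ha.pd j).continuous (hDj j)
    linarith [this 0, this 1, this 2]
  have h3 := (cellInt_pow_six_sq_le ha).trans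
    (pow_le_pow_left₀ (cellInt_nonneg fun x => by positivity) h2 3)
  rw [← hA] at h3
  set X := √A
  set Y := √D
  have hX : A = X ^ 2 := (Real.sq_sqrt hA0).symm
  have hY : D = Y ^ 2 := (Real.sq_sqrt hD0).symm
  have hX0 : 0 ≤ X := Real.sqrt_nonneg _
  have hY0 : 0 ≤ Y := Real.sqrt_nonneg _
  rw [hX, hY]
  rw [hX] at h3
  -- `h3` reads `X⁴ ≤ 13³ X³ Y³`; division by `X³` leaves this, and squaring it gives `169³ =
  -- (13³)²`.
  have h4 : X ≤ 13 ^ 3 * Y ^ 3 := by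
    rcases hX0.eq_or_lt with h | h
    · rw [← h]; positivity
    · refine le_of_mul_le_mul_left ?_ (pow_pos h 3)
      linarith
  calc X ^ 2 ≤ (13 ^ 3 * Y ^ 3) ^ 2 := pow_le_pow_left₀ hX0 h4 2
    _ = _ := by ring

/-- The bound of a product in `L²` by the norm of one factor in `H¹` and the geometric mean of the
norms of the other one in `L²` and in `H¹`. -/
theorem cellInt_mul_sq_sq_le {a b : Pt → ℝ} (ha : IsPeriodicSmooth a) (ha0 : cellInt a = 0)
    (hb : IsPeriodicSmooth b) (hb0 : cellInt b = 0) :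
    cellInt (fun x => (a x * b x) ^ 2) ^ 2 ≤ 169 ^ 3 * (cellInt (fun x => b x ^ 2)
      * (∑ j, cellInt (fun x => pd j b x ^ 2)) * (∑ j, cellInt (fun x => pd j a x ^ 2)) ^ 2) := by
  have hA := cellInt_pow_six_le ha ha0
  have hB := cellInt_pow_six_le hb hb0
  have hDa0 : 0 ≤ ∑ j, cellInt (fun x => pd j a x ^ 2) :=
    Finset.sum_nonneg fun _ _ => cellInt_nonneg fun _ => sq_nonneg _
  have hDb0 : 0 ≤ ∑ j, cellInt (fun x => pd j b x ^ 2) :=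
    Finset.sum_nonneg fun _ _ => cellInt_nonneg fun _ => sq_nonneg _
  set Da := ∑ j, cellInt (fun x => pd j a x ^ 2)
  set Db := ∑ j, cellInt (fun x => pd j b x ^ 2)
  set J := cellInt (fun x => (a x ^ 2 * b x) ^ 2) with hJ
  set J' := cellInt (fun x => (a x * b x ^ 2) ^ 2) with hJ'
  have h1 : cellInt (fun x => (a x * b x) ^ 2) ^ 2 ≤ cellInt (fun x => b x ^ 2) * J := by
    convert cellInt_mul_sq_le hb.isL2 ((ha.pow 2).mul hb).isL2 using 3
    ext x; ring
  -- `h2` and `h3` replace Hölder's inequality by two applications of Cauchy–Schwarz: eliminating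
  -- `J'` gives `J³ ≤ A² B`, that is, `∫ a⁴b² ≤ (∫ a⁶)^(2/3) (∫ b⁶)^(1/3)`.
  have h2 : J ^ 2 ≤ cellInt (fun x => a x ^ 6) * J' := by
    convert cellInt_mul_sq_le (ha.pow 3).isL2 (ha.mul (hb.pow 2)).isL2 using 3
    · ext x; ring
    · ext x; ring
  have h3 : J' ^ 2 ≤ J * cellInt (fun x => b x ^ 6) := by
    convert cellInt_mul_sq_le ((ha.pow 2).mul hb).isL2 (hb.pow 3).isL2 using 3
    · ext x; ring
    · ext x; ring
  have hJ0 : 0 ≤ J := cellInt_nonneg fun _ => sq_nonneg _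
  have hA0 : 0 ≤ cellInt (fun x => a x ^ 6) := cellInt_nonneg fun x => by positivity
  have hB0 : 0 ≤ cellInt (fun x => b x ^ 6) := cellInt_nonneg fun x => by positivity
  have hb20 : 0 ≤ cellInt (fun x => b x ^ 2) := cellInt_nonneg fun x => by positivity
  set A := cellInt (fun x => a x ^ 6)
  set B := cellInt (fun x => b x ^ 6)
  have h4 : J ^ 4 ≤ A ^ 2 * (J * B) := calc
    J ^ 4 = (J ^ 2) ^ 2 := by ring
    _ ≤ (A * J') ^ 2 := pow_le_pow_left₀ (sq_nonneg _) h2 2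
    _ = A ^ 2 * J' ^ 2 := by ring
    _ ≤ A ^ 2 * (J * B) := mul_le_mul_of_nonneg_left h3 (sq_nonneg _)
  have h5 : J ≤ 169 ^ 3 * (Da ^ 2 * Db) := by
    rcases hJ0.eq_or_lt with h | h
    · rw [← h]; positivity
    · refine le_of_pow_le_pow_left₀ three_ne_zero (by positivity) ?_
      refine le_of_mul_le_mul_left ?_ h
      calc J * J ^ 3 = J ^ 4 := by ring
        _ ≤ A ^ 2 * (J * B) := h4
        _ ≤ (169 ^ 3 * Da ^ 3) ^ 2 * (J * (169 ^ 3 * Db ^ 3)) := by gcongr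
        _ = J * (169 ^ 3 * (Da ^ 2 * Db)) ^ 3 := by ring
  calc _ ≤ _ := h1
    _ ≤ cellInt (fun x => b x ^ 2) * (169 ^ 3 * (Da ^ 2 * Db)) :=
        mul_le_mul_of_nonneg_left h5 hb20
    _ = _ := by ring

theorem IsH1.tendsto_sum_pd_partialSum {v : Pt → ℝ} {Dv : Fin 3 → Pt → ℝ} (h : IsH1 v Dv) :
    Tendsto (fun S => ∑ j, cellInt (fun x => pd j (partialSum S v) x ^ 2)) atTop
      (𝓝 (∑ j, cellInt (fun x => Dv j x ^ 2))) := by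
  simp only [h.pd_partialSum_eq]
  exact tendsto_finsetSum _ fun j _ => tendsto_cellInt_sq (fun S => partialSum_isL2 S _)
    (h.grad_memL2 j) (tendsto_partialSum (h.grad_memL2 j))

theorem tendsto_partialSum_mul_sq {v φ : Pt → ℝ} (hv : IsL2 v) (hφ : Continuous φ) :
    Tendsto (fun S => cellInt (fun x => (partialSum S v x * φ x) ^ 2)) atTop
      (𝓝 (cellInt (fun x => (v x * φ x) ^ 2))) :=
  tendsto_cellInt_sq (fun S => (partialSum_isL2 S v).mul_continuous hφ) (hv.mul_continuous hφ)
    (tendsto_cellInt_sub_mul_sq (fun S => partialSum_isL2 S v) hv hφ (tendsto_partialSum hv))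

theorem IsH1.cellInt_mul_sq_sq_le_left {v : Pt → ℝ} {Dv : Fin 3 → Pt → ℝ} (h : IsH1 v Dv)
    (hv : cellInt v = 0) {b : Pt → ℝ} (hb : IsPeriodicSmooth b) (hb0 : cellInt b = 0) :
    cellInt (fun x => (v x * b x) ^ 2) ^ 2 ≤ 169 ^ 3 * (cellInt (fun x => b x ^ 2)
      * (∑ j, cellInt (fun x => pd j b x ^ 2)) * (∑ j, cellInt (fun x => Dv j x ^ 2)) ^ 2) :=
  le_of_tendsto_of_tendsto' ((tendsto_partialSum_mul_sq h.memL2 hb.continuous).pow 2)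
    (((h.tendsto_sum_pd_partialSum.pow 2).const_mul _).const_mul _) fun S =>
    cellInt_mul_sq_sq_le (isPeriodicSmooth_partialSum S v) (cellInt_partialSum hv S) hb hb0

/-- The companion estimate with the roles exchanged: the rough factor now carries the geometric mean
and the smooth one the full gradient norm. -/
theorem IsH1.cellInt_mul_sq_sq_le_right {v : Pt → ℝ} {Dv : Fin 3 → Pt → ℝ} (h : IsH1 v Dv)
    (hv : cellInt v = 0) {a : Pt → ℝ} (ha : IsPeriodicSmooth a) (ha0 : cellInt a = 0) :
    cellInt (fun x => (v x * a x) ^ 2) ^ 2 ≤ 169 ^ 3 * (cellInt (fun x => v x ^ 2)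
      * (∑ j, cellInt (fun x => Dv j x ^ 2)) * (∑ j, cellInt (fun x => pd j a x ^ 2)) ^ 2) := by
  refine le_of_tendsto_of_tendsto' ((tendsto_partialSum_mul_sq h.memL2 ha.continuous).pow 2)
    ((((tendsto_cellInt_sq (fun S => partialSum_isL2 S v) h.memL2
      (tendsto_partialSum h.memL2)).mul h.tendsto_sum_pd_partialSum).mul_const _).const_mul _)
    fun S => ?_
  have := cellInt_mul_sq_sq_le ha ha0 (isPeriodicSmooth_partialSum S v) (cellInt_partialSum hv S)
  simpa only [mul_comm (a _)] using this

/-- The `L²` inner product of finite families of functions. -/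
noncomputable def famInner {ι : Type*} [Fintype ι] (v w : ι → Pt → ℝ) : ℝ :=
  ∑ i, cellInt (fun x => v i x * w i x)

section FamInner

variable {ι : Type*} [Fintype ι] {u v w : ι → Pt → ℝ}

theorem famInner_comm (v w : ι → Pt → ℝ) : famInner v w = famInner w v :=
  Finset.sum_congr rfl fun _ _ => cellInt_congr fun _ => mul_comm _ _

theorem famInner_add_left (hu : ∀ i, IsL2 (u i)) (hv : ∀ i, IsL2 (v i)) (hw : ∀ i, IsL2 (w i)) :
    famInner (fun i x => u i x + v i x) w = famInner u w + famInner v w := by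
  simp only [famInner, add_mul, ← Finset.sum_add_distrib]
  exact Finset.sum_congr rfl fun i _ =>
    cellInt_add ((hu i).integrable_mul (hw i)) ((hv i).integrable_mul (hw i))

theorem famInner_sub_left (hu : ∀ i, IsL2 (u i)) (hv : ∀ i, IsL2 (v i)) (hw : ∀ i, IsL2 (w i)) :
    famInner (fun i x => u i x - v i x) w = famInner u w - famInner v w := by
  simp only [famInner, sub_mul, ← Finset.sum_sub_distrib]
  exact Finset.sum_congr rfl fun i _ =>
    cellInt_sub ((hu i).integrable_mul (hw i)) ((hv i).integrable_mul (hw i))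

theorem famInner_smul_left (c : ℝ) (u w : ι → Pt → ℝ) :
    famInner (fun i x => c * u i x) w = c * famInner u w := by
  simp only [famInner, mul_assoc, cellInt_const_mul, Finset.mul_sum]

theorem famInner_add_right (hu : ∀ i, IsL2 (u i)) (hv : ∀ i, IsL2 (v i)) (hw : ∀ i, IsL2 (w i)) :
    famInner w (fun i x => u i x + v i x) = famInner w u + famInner w v := by
  rw [famInner_comm, famInner_add_left hu hv hw, famInner_comm u, famInner_comm v]

theorem famInner_smul_right (c : ℝ) (u w : ι → Pt → ℝ) :
    famInner w (fun i x => c * u i x) = c * famInner w u := by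
  rw [famInner_comm, famInner_smul_left, famInner_comm]

theorem famInner_self (v : ι → Pt → ℝ) : famInner v v = normSq v := by
  simp only [famInner, normSq, pow_two]

theorem famInner_sq_le (hv : ∀ i, IsL2 (v i)) (hw : ∀ i, IsL2 (w i)) :
    famInner v w ^ 2 ≤ normSq v * normSq w := sum_cellInt_mul_sq_le v w hv hw

theorem abs_famInner_le (hv : ∀ i, IsL2 (v i)) (hw : ∀ i, IsL2 (w i)) :
    |famInner v w| ≤ √(normSq v) * √(normSq w) := abs_sum_cellInt_mul_le v w hv hw

end FamInner

/-- A tensor field as a family indexed by pairs. -/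
def entries (A : TField) (p : Fin 3 × Fin 3) : Pt → ℝ := A p.1 p.2

/-- The gradient of a vector field with classical partial derivatives. -/
noncomputable def grad (φ : VField) : TField := fun i j => pd j (φ i)

/-- The entries `φ i * w j` of the tensor product of two vector fields. -/
def tensor (φ w : VField) : Fin 3 × Fin 3 → Pt → ℝ := fun p x => w p.2 x * φ p.1 x

theorem normSq_entries (A : TField) : normSq (entries A) = tensorSq A :=
  (tensorSq_eq_normSq A).symm

/-- Smooth periodic solenoidal vector fields with vanishing mean. -/
structure IsSolenoidal (φ : VField) : Prop where
  smooth : ∀ i, IsPeriodicSmooth (φ i)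
  div : ∀ x, ∑ i, pd i (φ i) x = 0
  mean : ∀ i, cellInt (φ i) = 0

namespace IsSolenoidal

variable {φ ψ : VField}

theorem isL2 (h : IsSolenoidal φ) (i : Fin 3) : IsL2 (φ i) := (h.smooth i).isL2

theorem isL2_grad (h : IsSolenoidal φ) (p : Fin 3 × Fin 3) : IsL2 (entries (grad φ) p) :=
  ((h.smooth p.1).pd p.2).isL2

theorem isL2_tensor (h : IsSolenoidal φ) {w : VField} (hw : ∀ i, IsL2 (w i)) (p : Fin 3 × Fin 3) :
    IsL2 (tensor φ w p) := (hw p.2).mul_continuous (h.smooth p.1).continuous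

theorem l2Sq_le_tensorSq (h : IsSolenoidal φ) : normSq φ ≤ tensorSq (grad φ) :=
  Finset.sum_le_sum fun i _ => (h.smooth i).isH1.poincare (h.mean i)

end IsSolenoidal

/-! ### The bilinear form of an Euler step -/

section Forms

/-- The bilinear form of a step of the scheme with drift `w`, applied to the field `v` with the
gradient `A` and to the test field `φ`. -/
noncomputable def eulerForm (ν k : ℝ) (w v : VField) (A : TField) (φ : VField) : ℝ :=
  famInner v φ / k + famInner (entries A) (tensor φ w) + ν * famInner (entries A) (entries (grad φ))

variable {ν k : ℝ} {g w u : VField} {Du : TField}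

theorem IsEulerStep.eulerForm_eq (hw : ∀ i, IsL2 (w i)) (hu : ∀ i, IsL2 (u i))
    (h : IsEulerStep ν k g w u Du) {φ : VField} (hφ : ∀ i, IsPeriodicSmooth (φ i))
    (hdiv : ∀ x, ∑ i, pd i (φ i) x = 0) :
    eulerForm ν k w u Du φ = famInner g φ + famInner w φ / k := by
  have h1 := h φ hφ hdiv
  have h2 : ∑ i, cellInt (fun x => (u i x - w i x) / k * φ i x)
      = famInner u φ / k - famInner w φ / k := by
    rw [← sub_div, ← famInner_sub_left hu hw fun i => (hφ i).isL2, famInner, Finset.sum_div]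
    refine Finset.sum_congr rfl fun i _ => ?_
    rw [div_eq_inv_mul, ← cellInt_const_mul]
    exact cellInt_congr fun x => by ring
  have h3 : ∑ i, ∑ j, cellInt (fun x => w j x * Du i j x * φ i x)
      = famInner (entries Du) (tensor φ w) := by
    rw [famInner, Fintype.sum_prod_type]
    exact Finset.sum_congr rfl fun i _ => Finset.sum_congr rfl fun j _ =>
      cellInt_congr fun x => by simp only [entries, tensor]; ring
  have h4 : ∑ i, ∑ j, cellInt (fun x => Du i j x * pd j (φ i) x)
      = famInner (entries Du) (entries (grad φ)) := by
    rw [famInner, Fintype.sum_prod_type]; rfl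
  rw [h2, h3, h4] at h1
  rw [eulerForm]
  change _ = famInner g φ at h1
  linarith

/-- The transport term vanishes when it is tested with the transported field. -/
theorem famInner_grad_tensor_self (hw : ∀ i, IsL2 (w i)) (hdiv : IsDivFree w) {φ : VField}
    (hφ : ∀ i, IsPeriodicSmooth (φ i)) : famInner (entries (grad φ)) (tensor φ w) = 0 := by
  -- The divergence condition on `w` is tested with `|φ|²`, whose gradient is twice the transport
  -- integrand.
  have h := hdiv _ (IsPeriodicSmooth.sum Finset.univ fun i _ => (hφ i).pow 2)
  have h1 : ∀ j x, pd j (fun x => ∑ i, φ i x ^ 2) x = ∑ i, 2 * (φ i x * pd j (φ i) x) := by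
    intro j x
    rw [pd_sum _ fun i _ => ((hφ i).pow 2).differentiableAt x]
    refine Finset.sum_congr rfl fun i _ => ?_
    rw [pd_pow ((hφ i).differentiableAt x)]
    push_cast; ring
  have h2 : ∀ j, cellInt (fun x => w j x * pd j (fun x => ∑ i, φ i x ^ 2) x)
      = ∑ i, 2 * cellInt (fun x => entries (grad φ) (i, j) x * tensor φ w (i, j) x) := by
    intro j
    simp only [h1, Finset.mul_sum]
    rw [cellInt_sum]
    · refine Finset.sum_congr rfl fun i _ => ?_
      rw [← cellInt_const_mul]
      exact cellInt_congr fun x => by simp only [entries, tensor, grad]; ring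
    · intro i _
      exact ((hw j).mul_continuous
        (((hφ i).mul ((hφ i).pd j)).const_mul 2).continuous).integrable
  simp only [h2, ← Finset.mul_sum] at h
  rw [famInner, Fintype.sum_prod_type, Finset.sum_comm]
  linarith

theorem eulerForm_self (hw : ∀ i, IsL2 (w i)) (hdiv : IsDivFree w) {φ : VField}
    (hφ : ∀ i, IsPeriodicSmooth (φ i)) :
    eulerForm ν k w φ (grad φ) φ = normSq φ / k + ν * tensorSq (grad φ) := by
  rw [eulerForm, famInner_grad_tensor_self hw hdiv hφ, famInner_self, famInner_self,
    normSq_entries, add_zero]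

theorem eulerForm_sub_left {v v' : VField} {A A' : TField} {φ : VField} (hw : ∀ i, IsL2 (w i))
    (hv : ∀ i, IsL2 (v i)) (hv' : ∀ i, IsL2 (v' i)) (hA : ∀ p, IsL2 (entries A p))
    (hA' : ∀ p, IsL2 (entries A' p)) (hφ : IsSolenoidal φ) :
    eulerForm ν k w (fun i x => v i x - v' i x) (fun i j x => A i j x - A' i j x) φ
      = eulerForm ν k w v A φ - eulerForm ν k w v' A' φ := by
  have h1 : entries (fun i j x => A i j x - A' i j x)
      = fun p x => entries A p x - entries A' p x := rfl
  rw [eulerForm, h1, famInner_sub_left hv hv' hφ.isL2, famInner_sub_left hA hA' (hφ.isL2_tensor hw),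
    famInner_sub_left hA hA' hφ.isL2_grad, eulerForm, eulerForm]
  ring

/-- The transport term is bounded in terms of the `H¹` norms. -/
theorem normSq_tensor_le {Dw : TField} (hw : ∀ i, IsH1 (w i) (Dw i)) (hw0 : HasZeroMean w)
    {φ : VField} (hφ : IsSolenoidal φ) :
    normSq (tensor φ w) ≤ 13 ^ 3 * (tensorSq Dw * tensorSq (grad φ)) := by
  have h1 : ∀ i j, cellInt (fun x => tensor φ w (i, j) x ^ 2)
      ≤ 13 ^ 3 * (normSq (Dw j) * normSq (grad φ i)) := fun i j => by
    have h2 := (hw j).cellInt_mul_sq_sq_le_left (hw0 j) (hφ.smooth i) (hφ.mean i)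
    have h3 := (hφ.smooth i).isH1.poincare (hφ.mean i)
    change _ ≤ normSq (grad φ i) at h3
    change cellInt (fun x => tensor φ w (i, j) x ^ 2) ^ 2
      ≤ _ * (_ * normSq (grad φ i) * normSq (Dw j) ^ 2) at h2
    have ha := normSq_nonneg (grad φ i)
    have hb := normSq_nonneg (Dw j)
    refine le_of_sq_le_sq ?_ (by positivity)
    calc _ ≤ _ := h2
      _ ≤ 169 ^ 3 * (normSq (grad φ i) * normSq (grad φ i) * normSq (Dw j) ^ 2) := by gcongr
      _ = _ := by ring
  rw [normSq, Fintype.sum_prod_type, tensorSq_eq_sum_normSq, tensorSq_eq_sum_normSq,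
    Finset.sum_mul_sum, Finset.sum_comm, Finset.mul_sum]
  simp only [Finset.mul_sum]
  exact Finset.sum_le_sum fun j _ => Finset.sum_le_sum fun i _ => h1 i j

end Forms

/-! ### Galerkin spaces and solvability of the discrete problem -/

section LinearAlgebra

/-- Solvability of a linear variational problem on a finite-dimensional space. -/
theorem exists_forall_bilin_eq {V : Type*} [AddCommGroup V] [Module ℝ V] [FiniteDimensional ℝ V]
    (B : V →ₗ[ℝ] V →ₗ[ℝ] ℝ) (ℓ : V →ₗ[ℝ] ℝ) (h : ∀ v, B v v = 0 → ℓ v = 0) :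
    ∃ u, ∀ v, B u v = ℓ v := by
  -- In finite dimension the range of `B` is the annihilator of its coannihilator, and any `v` in
  -- the latter satisfies `B v v = 0`.
  have h1 : ℓ ∈ LinearMap.range B := by
    rw [← Subspace.dualCoannihilator_dualAnnihilator_eq (W := LinearMap.range B),
      Submodule.mem_dualAnnihilator]
    intro v hv
    rw [Submodule.mem_dualCoannihilator] at hv
    exact h v (hv _ (LinearMap.mem_range_self B v))
  obtain ⟨u, hu⟩ := h1
  exact ⟨u, fun v => by rw [hu]⟩

end LinearAlgebra

section GalerkinSpace

/-- The trigonometric polynomials with wave vectors in `S`. -/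
def trigSpan (S : Finset (Fin 3 → ℤ)) : Submodule ℝ (Pt → ℝ) :=
  Submodule.span ℝ ((fun k x => Real.cos (phase k x)) '' (S : Set (Fin 3 → ℤ))
    ∪ (fun k x => Real.sin (phase k x)) '' (S : Set (Fin 3 → ℤ)))

instance finiteDimensional_trigSpan (S : Finset (Fin 3 → ℤ)) : FiniteDimensional ℝ (trigSpan S) :=
  FiniteDimensional.span_of_finite ℝ ((S.finite_toSet.image _).union (S.finite_toSet.image _))

variable {S : Finset (Fin 3 → ℤ)}

theorem cos_phase_mem_trigSpan {k : Fin 3 → ℤ} (hk : k ∈ S) :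
    (fun x => Real.cos (phase k x)) ∈ trigSpan S :=
  Submodule.subset_span (Or.inl ⟨k, hk, rfl⟩)

theorem sin_phase_mem_trigSpan {k : Fin 3 → ℤ} (hk : k ∈ S) :
    (fun x => Real.sin (phase k x)) ∈ trigSpan S :=
  Submodule.subset_span (Or.inr ⟨k, hk, rfl⟩)

theorem partialSum_mem_trigSpan (S : Finset (Fin 3 → ℤ)) (v : Pt → ℝ) :
    partialSum S v ∈ trigSpan S := by
  have h : partialSum S v = ((2 * Real.pi) ^ 3)⁻¹ • ∑ k ∈ S,
      (cosCoeff v k • (fun x => Real.cos (phase k x)) + sinCoeff v k • fun x => Real.sin (phase k x)) := by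
    ext x
    simp [partialSum]
  rw [h]
  exact Submodule.smul_mem _ _ (Submodule.sum_mem _ fun k hk => Submodule.add_mem _
    (Submodule.smul_mem _ _ (cos_phase_mem_trigSpan hk))
    (Submodule.smul_mem _ _ (sin_phase_mem_trigSpan hk)))

theorem trigSpan_properties {v : Pt → ℝ} (hv : v ∈ trigSpan S) :
    IsPeriodicSmooth v ∧ ∀ j, pd j v ∈ trigSpan S := by
  induction hv using Submodule.span_induction with
  | mem v hv =>
    rcases hv with ⟨k, hk, rfl⟩ | ⟨k, hk, rfl⟩
    · refine ⟨isPeriodicSmooth_cos_phase k, fun j => ?_⟩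
      have : pd j (fun x => Real.cos (phase k x)) = (-(k j : ℝ)) • fun x => Real.sin (phase k x) := by
        ext x; simp [pd_cos_phase]
      simp only [this]
      exact Submodule.smul_mem _ _ (sin_phase_mem_trigSpan hk)
    · refine ⟨isPeriodicSmooth_sin_phase k, fun j => ?_⟩
      have : pd j (fun x => Real.sin (phase k x)) = (k j : ℝ) • fun x => Real.cos (phase k x) := by
        ext x; simp [pd_sin_phase]
      simp only [this]
      exact Submodule.smul_mem _ _ (cos_phase_mem_trigSpan hk)
  | zero =>
    refine ⟨IsPeriodicSmooth.const 0, fun j => ?_⟩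
    have : pd j (0 : Pt → ℝ) = 0 := funext fun x => pd_const 0
    rw [this]
    exact Submodule.zero_mem _
  | add v w _ _ hv hw =>
    refine ⟨hv.1.add hw.1, fun j => ?_⟩
    have : pd j (v + w) = pd j v + pd j w :=
      funext fun x => pd_add (hv.1.differentiableAt x) (hw.1.differentiableAt x)
    rw [this]
    exact Submodule.add_mem _ (hv.2 j) (hw.2 j)
  | smul c v _ hv =>
    refine ⟨hv.1.const_mul c, fun j => ?_⟩
    have : pd j (c • v) = c • pd j v := funext fun x => pd_const_mul (hv.1.differentiableAt x) c
    rw [this]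
    exact Submodule.smul_mem _ _ (hv.2 j)

theorem IsSolenoidal.add {φ ψ : VField} (hφ : IsSolenoidal φ) (hψ : IsSolenoidal ψ) :
    IsSolenoidal (fun i x => φ i x + ψ i x) where
  smooth i := (hφ.smooth i).add (hψ.smooth i)
  div x := by
    simp only [pd_add ((hφ.smooth _).differentiableAt x) ((hψ.smooth _).differentiableAt x),
      Finset.sum_add_distrib, hφ.div, hψ.div, add_zero]
  mean i := by
    rw [cellInt_add (hφ.smooth i).integrable (hψ.smooth i).integrable, hφ.mean, hψ.mean, add_zero]

theorem IsSolenoidal.const_mul {φ : VField} (hφ : IsSolenoidal φ) (c : ℝ) :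
    IsSolenoidal (fun i x => c * φ i x) where
  smooth i := (hφ.smooth i).const_mul c
  div x := by
    simp only [pd_const_mul ((hφ.smooth _).differentiableAt x), ← Finset.mul_sum, hφ.div, mul_zero]
  mean i := by rw [cellInt_const_mul, hφ.mean, mul_zero]

theorem grad_add {φ ψ : VField} (hφ : IsSolenoidal φ) (hψ : IsSolenoidal ψ) :
    entries (grad (fun i x => φ i x + ψ i x))
      = fun p x => entries (grad φ) p x + entries (grad ψ) p x := by
  ext p x
  exact pd_add ((hφ.smooth _).differentiableAt x) ((hψ.smooth _).differentiableAt x)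

theorem grad_const_mul {φ : VField} (hφ : IsSolenoidal φ) (c : ℝ) :
    entries (grad (fun i x => c * φ i x)) = fun p x => c * entries (grad φ) p x := by
  ext p x
  exact pd_const_mul ((hφ.smooth _).differentiableAt x) c

/-- The vector Laplacian. -/
noncomputable def laplacian (φ : VField) : VField := fun i x => ∑ j, pd j (pd j (φ i)) x

theorem IsSolenoidal.laplacian {φ : VField} (hφ : IsSolenoidal φ) :
    IsSolenoidal (laplacian φ) where
  smooth i := IsPeriodicSmooth.sum _ fun j _ => ((hφ.smooth i).pd j).pd j
  div x := by
    have h1 : ∀ i, pd i (PeriodicNS.laplacian φ i) x = ∑ j, pd j (pd j (pd i (φ i))) x := by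
      intro i
      unfold PeriodicNS.laplacian
      rw [pd_sum _ fun j _ => (((hφ.smooth i).pd j).pd j).differentiableAt x]
      refine Finset.sum_congr rfl fun j _ => ?_
      rw [pd_comm ((hφ.smooth i).pd j).smooth]
      congr 1
      exact funext fun y => pd_comm (hφ.smooth i).smooth i j y
    simp only [h1]
    rw [Finset.sum_comm]
    refine Finset.sum_eq_zero fun j _ => ?_
    have h2 : ∀ y, pd j (fun z => ∑ i, pd i (φ i) z) y = ∑ i, pd j (pd i (φ i)) y := fun y =>
      pd_sum _ fun i _ => ((hφ.smooth i).pd i).differentiableAt y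
    have h3 : pd j (fun y => ∑ i, pd j (pd i (φ i)) y) x = ∑ i, pd j (pd j (pd i (φ i))) x :=
      pd_sum _ fun i _ => (((hφ.smooth i).pd i).pd j).differentiableAt x
    rw [← h3, ← funext h2]
    simp only [hφ.div]
    have h4 : pd j (fun _ : Pt => (0 : ℝ)) = fun _ => 0 := funext fun _ => pd_const 0
    rw [h4, pd_const]
  mean i := by
    unfold PeriodicNS.laplacian
    rw [cellInt_sum _ fun j _ => (((hφ.smooth i).pd j).pd j).integrable]
    exact Finset.sum_eq_zero fun j _ => cellInt_pd ((hφ.smooth i).pd j) j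

/-- The solenoidal trigonometric polynomials with vanishing mean and wave vectors in `S`. -/
def galerkinSpace (S : Finset (Fin 3 → ℤ)) : Submodule ℝ VField where
  carrier := {φ | (∀ i, φ i ∈ trigSpan S) ∧ IsSolenoidal φ}
  add_mem' h h' := ⟨fun i => Submodule.add_mem _ (h.1 i) (h'.1 i), h.2.add h'.2⟩
  zero_mem' := ⟨fun _ => Submodule.zero_mem _, fun _ => IsPeriodicSmooth.const 0, fun x => by
    have h : ∀ i : Fin 3, pd i ((0 : VField) i) x = 0 := fun i => pd_const 0
    simp only [h, Finset.sum_const_zero], fun i => by simp [cellInt]⟩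
  smul_mem' c _ h := ⟨fun i => Submodule.smul_mem _ c (h.1 i), h.2.const_mul c⟩

/-- The reason for choosing trigonometric polynomials: the Laplacian of the Galerkin solution
becomes an admissible test field. -/
theorem laplacian_mem_galerkinSpace {φ : VField} (h : φ ∈ galerkinSpace S) :
    laplacian φ ∈ galerkinSpace S := by
  refine ⟨fun i => ?_, h.2.laplacian⟩
  have : laplacian φ i = ∑ j, pd j (pd j (φ i)) := by
    ext x; simp [laplacian]
  rw [this]
  exact Submodule.sum_mem _ fun j _ => (trigSpan_properties ((trigSpan_properties (h.1 i)).2 j)).2 j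

theorem partialSum_mem_galerkinSpace {u : VField} (hdiv : IsDivFree u) (h0 : HasZeroMean u)
    (S : Finset (Fin 3 → ℤ)) : (fun i => partialSum S (u i)) ∈ galerkinSpace S :=
  ⟨fun _ => partialSum_mem_trigSpan S _, fun _ => isPeriodicSmooth_partialSum S _,
    sum_pd_partialSum_eq_zero hdiv S, fun i => cellInt_partialSum (h0 i) S⟩

instance finiteDimensional_galerkinSpace (S : Finset (Fin 3 → ℤ)) :
    FiniteDimensional ℝ (galerkinSpace S) := by
  let e : galerkinSpace S →ₗ[ℝ] (Fin 3 → trigSpan S) :=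
    { toFun := fun φ i => ⟨φ.1 i, φ.2.1 i⟩
      map_add' := fun _ _ => rfl
      map_smul' := fun _ _ => rfl }
  refine FiniteDimensional.of_injective e fun φ ψ h => ?_
  ext i x
  have := congrFun h i
  exact congrFun (congrArg Subtype.val this) x

/-- The form of a step of the scheme on the Galerkin space. -/
noncomputable def eulerBilin (S : Finset (Fin 3 → ℤ)) (ν k : ℝ) {w : VField}
    (hw : ∀ i, IsL2 (w i)) : galerkinSpace S →ₗ[ℝ] galerkinSpace S →ₗ[ℝ] ℝ :=
  LinearMap.mk₂ ℝ (fun v φ => eulerForm ν k w v.1 (grad v.1) φ.1)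
    (fun v v' φ => by
      have h1 := grad_add v.2.2 v'.2.2
      change eulerForm ν k w (fun i x => v.1 i x + v'.1 i x) (grad (fun i x => v.1 i x + v'.1 i x)) φ.1 = _
      simp only [eulerForm, h1]
      rw [famInner_add_left v.2.2.isL2 v'.2.2.isL2 φ.2.2.isL2,
        famInner_add_left v.2.2.isL2_grad v'.2.2.isL2_grad (φ.2.2.isL2_tensor hw),
        famInner_add_left v.2.2.isL2_grad v'.2.2.isL2_grad φ.2.2.isL2_grad]
      ring)
    (fun c v φ => by
      have h1 := grad_const_mul v.2.2 c
      change eulerForm ν k w (fun i x => c * v.1 i x) (grad (fun i x => c * v.1 i x)) φ.1 = _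
      simp only [eulerForm, h1]
      rw [famInner_smul_left, famInner_smul_left, famInner_smul_left, smul_eq_mul]
      ring)
    (fun v φ φ' => by
      have h1 := grad_add φ.2.2 φ'.2.2
      have h2 : tensor (fun i x => φ.1 i x + φ'.1 i x) w
          = fun p x => tensor φ.1 w p x + tensor φ'.1 w p x := by
        ext p x; simp only [tensor]; ring
      change eulerForm ν k w v.1 (grad v.1) (fun i x => φ.1 i x + φ'.1 i x) = _
      simp only [eulerForm, h1, h2]
      rw [famInner_add_right φ.2.2.isL2 φ'.2.2.isL2 v.2.2.isL2,
        famInner_add_right (φ.2.2.isL2_tensor hw) (φ'.2.2.isL2_tensor hw) v.2.2.isL2_grad,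
        famInner_add_right φ.2.2.isL2_grad φ'.2.2.isL2_grad v.2.2.isL2_grad]
      ring)
    (fun c v φ => by
      have h1 := grad_const_mul φ.2.2 c
      have h2 : tensor (fun i x => c * φ.1 i x) w = fun p x => c * tensor φ.1 w p x := by
        ext p x; simp only [tensor]; ring
      change eulerForm ν k w v.1 (grad v.1) (fun i x => c * φ.1 i x) = _
      simp only [eulerForm, h1, h2]
      rw [famInner_smul_right, famInner_smul_right, famInner_smul_right, smul_eq_mul]
      ring)

/-- The inner product with a fixed field, as a functional on the Galerkin space. -/
noncomputable def innerFunctional (S : Finset (Fin 3 → ℤ)) {g : VField} (hg : ∀ i, IsL2 (g i)) :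
    galerkinSpace S →ₗ[ℝ] ℝ where
  toFun φ := famInner g φ.1
  map_add' φ ψ := famInner_add_right φ.2.2.isL2 ψ.2.2.isL2 hg
  map_smul' c φ := famInner_smul_right c φ.1 g

/-- On the diagonal the form equals `|φ|²/k + ν|∇φ|²`. It vanishes only if `|φ| = 0`, and then
Cauchy–Schwarz makes the right-hand side vanish as well. -/
theorem exists_galerkin_solution (S : Finset (Fin 3 → ℤ)) {ν k : ℝ} (hν : 0 < ν) (hk : 0 < k)
    {g w : VField} (hg : ∀ i, IsL2 (g i)) (hw : ∀ i, IsL2 (w i)) (hdiv : IsDivFree w) :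
    ∃ v ∈ galerkinSpace S, ∀ φ ∈ galerkinSpace S,
      eulerForm ν k w v (grad v) φ = famInner g φ + famInner w φ / k := by
  obtain ⟨v, hv⟩ := exists_forall_bilin_eq (eulerBilin S ν k hw)
    (innerFunctional S hg + k⁻¹ • innerFunctional S hw) fun φ hφ => by
      change eulerForm ν k w φ.1 (grad φ.1) φ.1 = 0 at hφ
      rw [eulerForm_self hw hdiv φ.2.2.smooth] at hφ
      have h1 := mul_nonneg hν.le (tensorSq_nonneg (grad φ.1))
      have h2 := div_nonneg (normSq_nonneg φ.1) hk.le
      have h3 : normSq φ.1 = 0 := by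
        have : normSq φ.1 / k = 0 := by linarith
        simpa [hk.ne'] using this
      have h4 : ∀ {z : VField}, (∀ i, IsL2 (z i)) → famInner z φ.1 = 0 := fun hz => by
        have := famInner_sq_le hz φ.2.2.isL2
        rw [h3, mul_zero] at this
        exact pow_eq_zero_iff two_ne_zero |>.1 (le_antisymm this (sq_nonneg _))
      change famInner g φ.1 + k⁻¹ * famInner w φ.1 = 0
      rw [h4 hg, h4 hw]
      ring
  refine ⟨v.1, v.2, fun φ hφ => ?_⟩
  have := hv ⟨φ, hφ⟩
  rw [div_eq_inv_mul]
  exact this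

end GalerkinSpace

/-! ### Convergence of the Galerkin approximations -/

section Galerkin

variable {ν k : ℝ} {g w u : VField} {Dw Du : TField}

theorem isL2_entries (hu : ∀ i, IsH1 (u i) (Du i)) (p : Fin 3 × Fin 3) : IsL2 (entries Du p) :=
  (hu p.1).grad_memL2 p.2

theorem abs_eulerForm_le (hν : 0 < ν) (hk : 0 < k) (hw : ∀ i, IsH1 (w i) (Dw i))
    (hw0 : HasZeroMean w) {η : VField} {A : TField} (hη : ∀ i, IsL2 (η i))
    (hA : ∀ p, IsL2 (entries A p)) {φ : VField} (hφ : IsSolenoidal φ) :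
    |eulerForm ν k w η A φ| ≤ √(normSq η) * √(normSq φ) / k
      + (√(13 ^ 3 * tensorSq Dw) + ν) * (√(tensorSq A) * √(tensorSq (grad φ))) := by
  have h1 := abs_famInner_le hη hφ.isL2
  have h2 := abs_famInner_le hA (hφ.isL2_tensor fun i => (hw i).memL2)
  have h3 := abs_famInner_le hA hφ.isL2_grad
  rw [normSq_entries] at h2 h3
  rw [normSq_entries] at h3
  have h4 : √(normSq (tensor φ w)) ≤ √(13 ^ 3 * tensorSq Dw) * √(tensorSq (grad φ)) := by
    rw [← Real.sqrt_mul (mul_nonneg (by norm_num) (tensorSq_nonneg _)), mul_assoc]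
    exact Real.sqrt_le_sqrt (normSq_tensor_le hw hw0 hφ)
  have h5 := h2.trans (mul_le_mul_of_nonneg_left h4 (Real.sqrt_nonneg _))
  rw [eulerForm]
  refine (abs_add_three _ _ _).trans ?_
  rw [abs_div, abs_mul, abs_of_pos hk, abs_of_pos hν]
  have h6 := div_le_div_of_nonneg_right h1 hk.le
  have h7 := mul_le_mul_of_nonneg_left h3 hν.le
  generalize √(13 ^ 3 * tensorSq Dw) = M at h5 ⊢
  rw [mul_left_comm] at h5
  rw [add_mul]
  linarith

/-- Quasi-optimality of the Galerkin approximation. -/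
theorem galerkin_error_le (hν : 0 < ν) (hk : 0 < k) (hw : ∀ i, IsH1 (w i) (Dw i))
    (hw0 : HasZeroMean w) (hwdiv : IsDivFree w) (hu : ∀ i, IsH1 (u i) (Du i)) (hu0 : HasZeroMean u)
    (hudiv : IsDivFree u) (hstep : IsEulerStep ν k g w u Du) (S : Finset (Fin 3 → ℤ))
    {v : VField} (hv : v ∈ galerkinSpace S) (hvS : ∀ φ ∈ galerkinSpace S,
      eulerForm ν k w v (grad v) φ = famInner g φ + famInner w φ / k) :
    normSq (fun i x => partialSum S (u i) x - v i x) / k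
        + ν * tensorSq (grad (fun i x => partialSum S (u i) x - v i x))
      ≤ normSq (fun i x => u i x - partialSum S (u i) x) / k
        + (√(13 ^ 3 * tensorSq Dw) + ν) ^ 2 / ν
          * tensorSq (fun i j x => Du i j x - partialSum S (Du i j) x) := by
  have hwL := fun i => (hw i).memL2
  have huL := fun i => (hu i).memL2
  have hP := partialSum_mem_galerkinSpace hudiv hu0 S
  set P : VField := fun i => partialSum S (u i) with hPdef
  have hψ : (fun i x => P i x - v i x) ∈ galerkinSpace S := Submodule.sub_mem _ hP hv
  set ψ : VField := fun i x => P i x - v i x with hψdef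
  have hgP : grad P = fun i j => partialSum S (Du i j) := by
    ext i j x
    exact congrFun ((hu i).pd_partialSum_eq S j) x
  have hgψ : grad ψ = fun i j x => grad P i j x - grad v i j x := by
    ext i j x
    have := pd_add (j := j) ((hP.2.smooth i).differentiableAt x)
      (((hv.2.smooth i).const_mul (-1)).differentiableAt x)
    rw [pd_const_mul ((hv.2.smooth i).differentiableAt x)] at this
    simp only [neg_one_mul, ← sub_eq_add_neg] at this
    exact this
  -- Galerkin orthogonality: `u` and `v` satisfy the same equation against `ψ = P - v`, so `B(ψ, ψ)
  -- = -B(u - P, ψ)`, and the diagonal of `B` has no transport term.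
  have h1 := eulerForm_sub_left (ν := ν) (k := k) (φ := ψ) hwL hP.2.isL2 hv.2.isL2 hP.2.isL2_grad
    hv.2.isL2_grad hψ.2
  rw [← hgψ, ← hψdef, hvS ψ hψ, eulerForm_self hwL hwdiv hψ.2.smooth] at h1
  have h2 := eulerForm_sub_left (ν := ν) (k := k) (φ := ψ) hwL huL hP.2.isL2 (isL2_entries hu)
    hP.2.isL2_grad hψ.2
  rw [hstep.eulerForm_eq hwL huL hψ.2.smooth hψ.2.div] at h2
  have h3 := abs_eulerForm_le hν hk hw hw0 (η := fun i x => u i x - P i x)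
    (A := fun i j x => Du i j x - grad P i j x) (fun i => (huL i).sub (hP.2.isL2 i))
    (fun p => (isL2_entries hu p).sub (hP.2.isL2_grad p)) hψ.2
  have h4 := (neg_le_abs _).trans h3
  have h5 : (fun i j x => Du i j x - partialSum S (Du i j) x)
    = fun i j x => Du i j x - grad P i j x := by rw [hgP]
  rw [h5]
  have ea := Real.sq_sqrt (normSq_nonneg (fun i x => u i x - P i x))
  have eb := Real.sq_sqrt (normSq_nonneg ψ)
  have ec := Real.sq_sqrt (tensorSq_nonneg (fun i j x => Du i j x - grad P i j x))
  have ed := Real.sq_sqrt (tensorSq_nonneg (grad ψ))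
  set a := √(normSq (fun i x => u i x - P i x))
  set b := √(normSq ψ)
  set c := √(tensorSq (fun i j x => Du i j x - grad P i j x))
  set d := √(tensorSq (grad ψ))
  set M := √(13 ^ 3 * tensorSq Dw) + ν
  -- Young's inequality in `h6` and `h7` puts half of each term of `B(ψ, ψ)` on the right, to be
  -- absorbed; doubling what remains gives the claim.
  have h6 : a * b / k ≤ (a ^ 2 + b ^ 2) / 2 / k :=
    div_le_div_of_nonneg_right (by linarith [two_mul_le_add_sq a b]) hk.le
  have h7 : M * (c * d) ≤ (M ^ 2 / ν * c ^ 2 + ν * d ^ 2) / 2 := by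
    have h8 : M ^ 2 / ν * c ^ 2 + ν * d ^ 2 - 2 * (M * (c * d)) = (M * c - ν * d) ^ 2 / ν := by
      field_simp; ring
    have h9 : 0 ≤ (M * c - ν * d) ^ 2 / ν := by positivity
    linarith
  rw [← ea, ← ec]
  rw [← eb, ← ed] at h1 ⊢
  have h10 : (a ^ 2 + b ^ 2) / 2 / k = (a ^ 2 / k + b ^ 2 / k) / 2 := by ring
  linarith

theorem normSq_sub_comm {ι : Type*} [Fintype ι] (v w : ι → Pt → ℝ) :
    normSq (fun i x => v i x - w i x) = normSq (fun i x => w i x - v i x) :=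
  Finset.sum_congr rfl fun _ _ => cellInt_congr fun _ => by ring

theorem tendsto_normSq_partialSum {ι : Type*} [Fintype ι] {v : ι → Pt → ℝ} (hv : ∀ i, IsL2 (v i)) :
    Tendsto (fun S => normSq (fun i x => v i x - partialSum S (v i) x)) atTop (𝓝 0) := by
  have h := tendsto_finsetSum Finset.univ fun i _ => tendsto_partialSum (hv i)
  rw [Finset.sum_const_zero] at h
  exact h.congr fun S => normSq_sub_comm (fun i => partialSum S (v i)) v

/-- A step of the scheme is the limit in `H¹` of smooth fields that satisfy it when it is tested
with these fields and with their Laplacians. -/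
theorem exists_smooth_approximation (hν : 0 < ν) (hk : 0 < k) (hg : ∀ i, IsL2 (g i))
    (hw : ∀ i, IsH1 (w i) (Dw i)) (hw0 : HasZeroMean w) (hwdiv : IsDivFree w)
    (hu : ∀ i, IsH1 (u i) (Du i)) (hu0 : HasZeroMean u) (hudiv : IsDivFree u)
    (hstep : IsEulerStep ν k g w u Du) :
    ∃ φ : Finset (Fin 3 → ℤ) → VField, (∀ S, IsSolenoidal (φ S)) ∧
      (∀ S, eulerForm ν k w (φ S) (grad (φ S)) (φ S)
        = famInner g (φ S) + famInner w (φ S) / k) ∧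
      (∀ S, eulerForm ν k w (φ S) (grad (φ S)) (laplacian (φ S))
        = famInner g (laplacian (φ S)) + famInner w (laplacian (φ S)) / k) ∧
      Tendsto (fun S => normSq (φ S)) atTop (𝓝 (normSq u)) ∧
      Tendsto (fun S => tensorSq (grad (φ S))) atTop (𝓝 (tensorSq Du)) := by
  have hwL := fun i => (hw i).memL2
  have huL := fun i => (hu i).memL2
  choose φ hφ hφS using fun S => exists_galerkin_solution S hν hk hg hwL hwdiv
  have hη : Tendsto (fun S => normSq (fun i x => u i x - partialSum S (u i) x)) atTop (𝓝 0) :=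
    tendsto_normSq_partialSum huL
  have hDη : Tendsto (fun S => tensorSq (fun i j x => Du i j x - partialSum S (Du i j) x)) atTop
      (𝓝 0) := by
    simp only [tensorSq_eq_normSq]
    exact tendsto_normSq_partialSum (isL2_entries hu)
  have herr := ((hη.div_const k).add
    (hDη.const_mul ((√(13 ^ 3 * tensorSq Dw) + ν) ^ 2 / ν)))
  rw [zero_div, mul_zero, add_zero] at herr
  have hψ := squeeze_zero (fun S => add_nonneg (div_nonneg (normSq_nonneg _) hk.le)
    (mul_nonneg hν.le (tensorSq_nonneg _)))
    (fun S => galerkin_error_le hν hk hw hw0 hwdiv hu hu0 hudiv hstep S (hφ S) (hφS S)) herr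
  have hψ1 : Tendsto (fun S => normSq (fun i x => partialSum S (u i) x - φ S i x)) atTop (𝓝 0) := by
    refine squeeze_zero (fun _ => normSq_nonneg _) (fun S => ?_) (by simpa using hψ.const_mul k)
    rw [mul_add, mul_div_cancel₀ _ hk.ne']
    exact le_add_of_nonneg_right (mul_nonneg hk.le (mul_nonneg hν.le (tensorSq_nonneg _)))
  have hψ2 : Tendsto (fun S => tensorSq (grad (fun i x => partialSum S (u i) x - φ S i x))) atTop
      (𝓝 0) := by
    refine squeeze_zero (fun _ => tensorSq_nonneg _) (fun S => ?_) (by simpa using hψ.const_mul ν⁻¹)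
    rw [mul_add, inv_mul_cancel_left₀ hν.ne']
    exact le_add_of_nonneg_left (mul_nonneg (inv_nonneg.2 hν.le)
      (div_nonneg (normSq_nonneg _) hk.le))
  refine ⟨φ, fun S => (hφ S).2, fun S => hφS S _ (hφ S),
    fun S => hφS S _ (laplacian_mem_galerkinSpace (hφ S)), ?_, ?_⟩
  · refine tendsto_normSq (fun S => (hφ S).2.isL2) huL ?_
    refine squeeze_zero (fun _ => normSq_nonneg _) (fun S => ?_)
      (by simpa using (hη.const_mul 2).add (hψ1.const_mul 2))
    rw [normSq_sub_comm]
    refine le_trans (le_of_eq ?_) (normSq_add_le _ _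
      (fun i => (huL i).sub (partialSum_isL2 S (u i)))
      (fun i => (partialSum_isL2 S (u i)).sub ((hφ S).2.isL2 i)))
    exact Finset.sum_congr rfl fun _ _ => cellInt_congr fun _ => by ring
  · simp only [← normSq_entries]
    refine tendsto_normSq (fun S => (hφ S).2.isL2_grad) (isL2_entries hu) ?_
    refine squeeze_zero (fun _ => normSq_nonneg _) (fun S => ?_)
      (by simpa using (hDη.const_mul 2).add (hψ2.const_mul 2))
    have h1 : ∀ i j x, grad (fun i x => partialSum S (u i) x - φ S i x) i j x
        = partialSum S (Du i j) x - grad (φ S) i j x := fun i j x => by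
      have := pd_add (j := j) ((isPeriodicSmooth_partialSum S (u i)).differentiableAt x)
        ((((hφ S).2.smooth i).const_mul (-1)).differentiableAt x)
      rw [pd_const_mul (((hφ S).2.smooth i).differentiableAt x), (hu i).pd_partialSum_eq] at this
      simp only [neg_one_mul, ← sub_eq_add_neg] at this
      exact this
    have h2 : ∀ p, entries (grad (fun i x => partialSum S (u i) x - φ S i x)) p
        = fun x => partialSum S (Du p.1 p.2) x - grad (φ S) p.1 p.2 x :=
      fun p => funext (h1 p.1 p.2)
    rw [normSq_sub_comm, ← normSq_entries, ← normSq_entries]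
    refine le_trans (le_of_eq ?_) (normSq_add_le _ _
      (fun p => (isL2_entries hu p).sub (partialSum_isL2 S (Du p.1 p.2)))
      (fun p => h2 p ▸ (partialSum_isL2 S (Du p.1 p.2)).sub ((hφ S).2.isL2_grad p)))
    refine Finset.sum_congr rfl fun p _ => cellInt_congr fun x => ?_
    simp only [entries, h1]
    ring

/-- The mean is conserved by the scheme. -/
theorem IsEulerStep.hasZeroMean (hk : 0 < k) (hg0 : HasZeroMean g)
    (hw : ∀ i, IsH1 (w i) (Dw i)) (hw0 : HasZeroMean w) (hwdiv : IsDivFree w)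
    (hu : ∀ i, IsH1 (u i) (Du i)) (hstep : IsEulerStep ν k g w u Du) : HasZeroMean u := by
  intro m
  have h0 : ∀ i j (x : Pt), pd j ((fun i _ => if i = m then 1 else 0 : VField) i) x = 0 :=
    fun i j x => pd_const _
  -- The test field is the constant unit vector in the direction `m`, so the viscous term drops out.
  have h := hstep (fun i _ => if i = m then 1 else 0) (fun i => IsPeriodicSmooth.const _)
    fun x => by simp only [h0, Finset.sum_const_zero]
  simp only [h0, mul_zero, l2Inner, mul_ite, mul_one] at h
  have h1 : ∀ F : Fin 3 → Pt → ℝ, ∑ i, cellInt (fun x => if i = m then F i x else 0) = cellInt (F m) := by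
    intro F
    rw [Finset.sum_eq_single m]
    · simp
    · intro i _ hi
      simp [hi, cellInt]
    · simp
  have h2 : ∑ i, ∑ j, cellInt (fun x => if i = m then w j x * Du i j x else 0)
      = ∑ j, cellInt (fun x => w j x * Du m j x) := by
    rw [Finset.sum_eq_single m]
    · simp
    · intro i _ hi
      simp [hi, cellInt]
    · simp
  -- The divergence condition on `w` is only available for smooth potentials, so `u m` is replaced
  -- by its Fourier partial sums and the limit is taken.
  have h3 : ∑ j, cellInt (fun x => w j x * Du m j x) = 0 := by
    have h4 : Tendsto (fun S => ∑ j, cellInt (fun x => partialSum S (Du m j) x * w j x)) atTop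
        (𝓝 (∑ j, cellInt (fun x => Du m j x * w j x))) :=
      tendsto_finsetSum _ fun j _ => tendsto_cellInt_mul (fun S => partialSum_isL2 S _)
        ((hu m).grad_memL2 j) (hw j).memL2 (tendsto_partialSum ((hu m).grad_memL2 j))
    have h5 : ∀ S, ∑ j, cellInt (fun x => partialSum S (Du m j) x * w j x) = 0 := fun S => by
      rw [← hwdiv _ (isPeriodicSmooth_partialSum S (u m))]
      refine Finset.sum_congr rfl fun j _ => ?_
      rw [(hu m).pd_partialSum_eq]
      exact cellInt_congr fun x => mul_comm _ _
    simp only [h5] at h4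
    rw [tendsto_nhds_unique tendsto_const_nhds h4]
    exact Finset.sum_congr rfl fun j _ => cellInt_congr fun x => mul_comm _ _
  rw [h1 (fun i x => (u i x - w i x) / k), h2, h3, h1 g, hg0 m] at h
  have h6 : cellInt (fun x => (u m x - w m x) / k) = (cellInt (u m) - cellInt (w m)) / k := by
    rw [← cellInt_sub (hu m).memL2.integrable (hw m).memL2.integrable, div_eq_inv_mul,
      ← cellInt_const_mul]
    exact cellInt_congr fun x => div_eq_inv_mul _ _
  rw [h6, hw0 m] at h
  simpa [cellInt, hk.ne'] using h

end Galerkin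

/-! ### The `H⁻¹` norm -/

section DualNorm

variable {g : VField}

/-- By Poincaré with constant 1, competitors have `L²` norm at most 1. The set is therefore bounded
above, so its `sSup` is not a default value. -/
theorem hMinusOneNorm_bound (hg : ∀ i, IsL2 (g i)) {r : ℝ}
    (hr : r ∈ {r : ℝ | ∃ (v : VField) (Dv : TField), (∀ i, IsH1 (v i) (Dv i)) ∧ HasZeroMean v ∧
      tensorSq Dv ≤ 1 ∧ r = l2Inner g v}) : r ≤ √(l2Sq g) := by
  obtain ⟨v, Dv, hv, hv0, hDv, rfl⟩ := hr
  have h1 : normSq v ≤ 1 :=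
    (Finset.sum_le_sum fun i _ => (hv i).poincare (hv0 i) : normSq v ≤ tensorSq Dv).trans hDv
  calc l2Inner g v ≤ |famInner g v| := le_abs_self _
    _ ≤ √(normSq g) * √(normSq v) := abs_famInner_le hg fun i => (hv i).memL2
    _ ≤ √(normSq g) * 1 :=
      mul_le_mul_of_nonneg_left (Real.sqrt_le_one.2 h1) (Real.sqrt_nonneg _)
    _ = √(l2Sq g) := mul_one _

theorem le_hMinusOneNorm (hg : ∀ i, IsL2 (g i)) {v : VField} {Dv : TField}
    (hv : ∀ i, IsH1 (v i) (Dv i)) (hv0 : HasZeroMean v) (hDv : tensorSq Dv ≤ 1) :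
    l2Inner g v ≤ hMinusOneNorm g :=
  le_csSup ⟨_, fun _ hr => hMinusOneNorm_bound hg hr⟩ ⟨v, Dv, hv, hv0, hDv, rfl⟩

theorem isSolenoidal_zero : IsSolenoidal (0 : VField) := (galerkinSpace ∅).zero_mem.2

theorem hMinusOneNorm_nonneg (hg : ∀ i, IsL2 (g i)) : 0 ≤ hMinusOneNorm g := by
  have h1 : tensorSq (grad 0) = 0 := by
    have : grad (0 : VField) = fun _ _ _ => 0 := by
      ext i j x
      exact pd_const 0
    simp [this, tensorSq, cellInt]
  have h := le_hMinusOneNorm hg (fun i => (isSolenoidal_zero.smooth i).isH1)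
    isSolenoidal_zero.mean (by
      change tensorSq (grad 0) ≤ 1
      rw [h1]; exact zero_le_one)
  simpa [l2Inner, cellInt] using h

theorem hMinusOneNorm_le (hg : ∀ i, IsL2 (g i)) : hMinusOneNorm g ≤ √(l2Sq g) :=
  Real.sSup_le (fun _ hr => hMinusOneNorm_bound hg hr) (Real.sqrt_nonneg _)

/-- Rescale `φ` to unit gradient. If the gradient vanishes, Poincaré gives `|φ| = 0` and both sides
are zero. -/
theorem famInner_le_hMinusOneNorm (hg : ∀ i, IsL2 (g i)) {φ : VField} (hφ : IsSolenoidal φ) :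
    famInner g φ ≤ hMinusOneNorm g * √(tensorSq (grad φ)) := by
  rcases (tensorSq_nonneg (grad φ)).eq_or_lt with h | h
  · have h1 : normSq φ = 0 := le_antisymm (h ▸ hφ.l2Sq_le_tensorSq) (normSq_nonneg _)
    have h2 := famInner_sq_le hg hφ.isL2
    rw [h1, mul_zero] at h2
    rw [pow_eq_zero_iff two_ne_zero |>.1 (le_antisymm h2 (sq_nonneg _)), ← h]
    simp
  · have hs := Real.sqrt_pos.2 h
    set s := √(tensorSq (grad φ))
    have hφs := hφ.const_mul s⁻¹
    have h1 : tensorSq (grad fun i x => s⁻¹ * φ i x) ≤ 1 := by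
      rw [← normSq_entries, grad_const_mul hφ, ← famInner_self, famInner_smul_left,
        famInner_smul_right, famInner_self, normSq_entries]
      rw [← Real.sq_sqrt h.le]
      change s⁻¹ * (s⁻¹ * s ^ 2) ≤ 1
      rw [pow_two, inv_mul_cancel_left₀ hs.ne', inv_mul_cancel₀ hs.ne']
    have h2 := le_hMinusOneNorm hg (fun i => (hφs.smooth i).isH1) hφs.mean h1
    change famInner g (fun i x => s⁻¹ * φ i x) ≤ _ at h2
    rw [famInner_smul_right, inv_mul_le_iff₀ hs, mul_comm] at h2
    exact h2

end DualNorm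

/-! ### Energy, enstrophy and transport estimates for smooth fields -/

section SmoothEstimates

variable {ν k : ℝ} {g w φ : VField} {Dw : TField}

/-- The energy estimate. -/
theorem energy_le (hν : 0 < ν) (hk : 0 < k) (hg : ∀ i, IsL2 (g i)) (hw : ∀ i, IsL2 (w i))
    (hwdiv : IsDivFree w) (hφ : IsSolenoidal φ)
    (h : eulerForm ν k w φ (grad φ) φ = famInner g φ + famInner w φ / k) :
    normSq φ + ν * k * tensorSq (grad φ) ≤ normSq w + k / ν * hMinusOneNorm g ^ 2 := by
  rw [eulerForm_self hw hwdiv hφ.smooth] at h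
  have h1 := famInner_le_hMinusOneNorm hg hφ
  have h2 : 2 * famInner w φ ≤ normSq w + normSq φ := by
    have := normSq_sub w φ hw hφ.isL2
    have h0 := normSq_nonneg (fun i x => w i x - φ i x)
    change _ = normSq w - 2 * famInner w φ + normSq φ at this
    linarith
  have h3 : normSq φ + ν * k * tensorSq (grad φ) = k * famInner g φ + famInner w φ := by
    field_simp at h
    linarith
  have h4 := Real.sq_sqrt (tensorSq_nonneg (grad φ))
  set s := √(tensorSq (grad φ))
  rw [← h4] at h3 ⊢
  -- A completed square: of the dissipation `2νk|∇φ|²`, one half absorbs the forcing and the other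
  -- half stays in the estimate.
  have h5 : k / ν * hMinusOneNorm g ^ 2 + ν * k * s ^ 2 - 2 * k * (hMinusOneNorm g * s)
      = k / ν * (hMinusOneNorm g - ν * s) ^ 2 := by
    field_simp; ring
  have h6 : 0 ≤ k / ν * (hMinusOneNorm g - ν * s) ^ 2 := by positivity
  have h7 := mul_le_mul_of_nonneg_left h1 hk.le
  linarith

/-- The derivatives `∂ⱼφᵢ` serve as test functions in the weak gradient of `v`, so `v` in `H¹`
suffices; this is needed for the drift `w`. -/
theorem famInner_laplacian {v : VField} {Dv : TField} (hv : ∀ i, IsH1 (v i) (Dv i))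
    (hφ : ∀ i, IsPeriodicSmooth (φ i)) :
    famInner v (laplacian φ) = - famInner (entries Dv) (entries (grad φ)) := by
  rw [famInner, famInner, Fintype.sum_prod_type, ← Finset.sum_neg_distrib]
  refine Finset.sum_congr rfl fun i _ => ?_
  rw [← Finset.sum_neg_distrib]
  simp only [laplacian, Finset.mul_sum]
  rw [cellInt_sum _ fun j _ => (hv i).memL2.integrable_mul (((hφ i).pd j).pd j).isL2]
  exact Finset.sum_congr rfl fun j _ => (hv i).weak j _ ((hφ i).pd j)

theorem famInner_grad_laplacian (hφ : IsSolenoidal φ) :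
    famInner (entries (grad φ)) (entries (grad (laplacian φ))) = - normSq (laplacian φ) := by
  have h := famInner_laplacian (fun i => (hφ.laplacian.smooth i).isH1) hφ.smooth
  rw [famInner_self] at h
  rw [h, neg_neg, famInner_comm]
  rfl

/-- The Hessian of a periodic function is bounded by its Laplacian. -/
theorem sum_sq_hessian {φ : Pt → ℝ} (hφ : IsPeriodicSmooth φ) :
    ∑ j, ∑ m, cellInt (fun x => pd m (pd j φ) x ^ 2)
      = cellInt (fun x => (∑ j, pd j (pd j φ) x) ^ 2) := by
  have h1 : ∀ j m, cellInt (fun x => pd m (pd j φ) x ^ 2)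
      = cellInt (fun x => pd j (pd j φ) x * pd m (pd m φ) x) := fun j m => by
    have hj := hφ.pd j
    have hm := hφ.pd m
    -- Two integrations by parts: `∫ (∂ₘ∂ⱼφ)² = -∫ ∂ₘ∂ₘ∂ⱼφ ∂ⱼφ = ∫ ∂ₘ²φ ∂ⱼ²φ`.
    have e1 := cellInt_mul_pd (hj.pd m) hj m
    have e2 := cellInt_mul_pd (hm.pd m) hj j
    have e3 : pd m (pd m (pd j φ)) = pd j (pd m (pd m φ)) := by
      rw [funext (pd_comm hφ.smooth m j)]
      exact funext (pd_comm hm.smooth m j)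
    simp only [pow_two]
    rw [e1, e3, ← e2]
    exact cellInt_congr fun x => mul_comm _ _
  simp only [h1, pow_two (∑ j, _), Finset.sum_mul_sum]
  rw [cellInt_sum _ fun j _ => (IsPeriodicSmooth.sum _ fun m _ =>
    ((hφ.pd j).pd j).mul ((hφ.pd m).pd m)).integrable]
  refine Finset.sum_congr rfl fun j _ => ?_
  rw [cellInt_sum _ fun m _ => (((hφ.pd j).pd j).mul ((hφ.pd m).pd m)).integrable]

theorem normSq_grad_pd_le (hφ : ∀ i, IsPeriodicSmooth (φ i)) (i j : Fin 3) :
    ∑ m, cellInt (fun x => pd m (pd j (φ i)) x ^ 2) ≤ normSq (laplacian φ) := by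
  have h1 : ∑ m, cellInt (fun x => pd m (pd j (φ i)) x ^ 2)
      ≤ ∑ j, ∑ m, cellInt (fun x => pd m (pd j (φ i)) x ^ 2) :=
    Finset.single_le_sum (f := fun j => ∑ m, cellInt (fun x => pd m (pd j (φ i)) x ^ 2))
      (fun _ _ => Finset.sum_nonneg fun _ _ => cellInt_nonneg fun _ => sq_nonneg _)
      (Finset.mem_univ j)
  rw [sum_sq_hessian (hφ i)] at h1
  exact h1.trans (Finset.single_le_sum (f := fun i => cellInt (fun x => laplacian φ i x ^ 2))
    (fun _ _ => cellInt_nonneg fun _ => sq_nonneg _) (Finset.mem_univ i))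

theorem normSq_component_le {ι : Type*} [Fintype ι] (v : ι → Pt → ℝ) (i : ι) :
    cellInt (fun x => v i x ^ 2) ≤ normSq v :=
  Finset.single_le_sum (f := fun i => cellInt (fun x => v i x ^ 2))
    (fun _ _ => cellInt_nonneg fun _ => sq_nonneg _) (Finset.mem_univ i)

theorem normSq_row_le (A : TField) (i : Fin 3) : normSq (A i) ≤ tensorSq A :=
  Finset.single_le_sum (f := fun i => normSq (A i)) (fun _ _ => normSq_nonneg _) (Finset.mem_univ i)

/-- The squared norm of the transport term, entry by entry. -/
noncomputable def transportSq (w φ : VField) : ℝ :=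
  normSq (fun (p : Fin 3 × Fin 3) x => w p.2 x * grad φ p.1 p.2 x)

theorem transport_sq_le (hw : ∀ i, IsL2 (w i)) (hφ : IsSolenoidal φ) :
    famInner (entries (grad φ)) (tensor (laplacian φ) w) ^ 2
      ≤ 3 * transportSq w φ * normSq (laplacian φ) := by
  have h := famInner_sq_le
    (v := fun (p : Fin 3 × Fin 3) x => w p.2 x * grad φ p.1 p.2 x)
    (w := fun (p : Fin 3 × Fin 3) => laplacian φ p.1)
    (fun p => (hw p.2).mul_continuous ((hφ.smooth p.1).pd p.2).continuous)
    (fun p => hφ.laplacian.isL2 p.1)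
  -- Each component of the Laplacian is counted once for every direction `j` of the drift.
  have h1 : normSq (fun (p : Fin 3 × Fin 3) => laplacian φ p.1) = 3 * normSq (laplacian φ) := by
    simp [normSq, Fintype.sum_prod_type, ← Finset.mul_sum]
  rw [h1] at h
  have h2 : famInner (entries (grad φ)) (tensor (laplacian φ) w)
      = famInner (fun (p : Fin 3 × Fin 3) x => w p.2 x * grad φ p.1 p.2 x)
        (fun (p : Fin 3 × Fin 3) => laplacian φ p.1) :=
    Finset.sum_congr rfl fun p _ => cellInt_congr fun x => by simp only [entries, tensor]; ring
  rw [h2, transportSq]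
  linarith

theorem transportSq_sq_le_of_forall {Z : ℝ}
    (h : ∀ i j, cellInt (fun x => (w j x * grad φ i j x) ^ 2) ^ 2 ≤ Z) :
    transportSq w φ ^ 2 ≤ 81 * Z := by
  have hZ : 0 ≤ Z := (sq_nonneg _).trans (h 0 0)
  have h1 : transportSq w φ ≤ 9 * √Z := by
    rw [transportSq, normSq, Fintype.sum_prod_type]
    calc _ ≤ ∑ _i : Fin 3, ∑ _j : Fin 3, √Z := Finset.sum_le_sum fun i _ =>
          Finset.sum_le_sum fun j _ => Real.le_sqrt_of_sq_le (h i j)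
      _ = 9 * √Z := by simp; ring
  calc _ ≤ (9 * √Z) ^ 2 := pow_le_pow_left₀ (normSq_nonneg _) h1 2
    _ = 81 * Z := by rw [mul_pow, Real.sq_sqrt hZ]; norm_num

/-- The bound of the transport term by the gradient of the transporting field. -/
theorem transport_pow_four_le (hw : ∀ i, IsH1 (w i) (Dw i)) (hw0 : HasZeroMean w)
    (hφ : IsSolenoidal φ) :
    famInner (entries (grad φ)) (tensor (laplacian φ) w) ^ 4
      ≤ 59319 ^ 2 * (tensorSq (grad φ) * tensorSq Dw ^ 2 * normSq (laplacian φ) ^ 3) := by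
  have hD := tensorSq_nonneg (grad φ)
  have hW := tensorSq_nonneg Dw
  have hL := normSq_nonneg (laplacian φ)
  have h1 := transportSq_sq_le_of_forall (w := w) (φ := φ)
    (Z := 169 ^ 3 * (tensorSq (grad φ) * normSq (laplacian φ) * tensorSq Dw ^ 2)) fun i j => by
      -- The smooth factor `∂ⱼφᵢ` has vanishing mean because it is a derivative of a periodic
      -- function, and its own gradient is controlled by the Laplacian.
      refine ((hw j).cellInt_mul_sq_sq_le_left (hw0 j) ((hφ.smooth i).pd j)
        (cellInt_pd (hφ.smooth i) j)).trans ?_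
      have e1 := (normSq_component_le (grad φ i) j).trans (normSq_row_le (grad φ) i)
      have e2 := normSq_grad_pd_le hφ.smooth i j
      have e3 := normSq_row_le Dw j
      have e4 := normSq_nonneg (Dw j)
      change _ * (cellInt (fun x => grad φ i j x ^ 2) * _ * normSq (Dw j) ^ 2) ≤ _
      have e5 : 0 ≤ ∑ m, cellInt (fun x => pd m (pd j (φ i)) x ^ 2) :=
        Finset.sum_nonneg fun _ _ => cellInt_nonneg fun _ => sq_nonneg _
      gcongr
  have h2 := transport_sq_le (fun i => (hw i).memL2) hφ
  -- The constant is `9 · 81 · 169³ = (3³ · 13³)² = 59319²`.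
  calc _ = (famInner (entries (grad φ)) (tensor (laplacian φ) w) ^ 2) ^ 2 := by ring
    _ ≤ (3 * transportSq w φ * normSq (laplacian φ)) ^ 2 := pow_le_pow_left₀ (sq_nonneg _) h2 2
    _ = 9 * transportSq w φ ^ 2 * normSq (laplacian φ) ^ 2 := by ring
    _ ≤ 9 * (81 * (169 ^ 3 * (tensorSq (grad φ) * normSq (laplacian φ) * tensorSq Dw ^ 2)))
        * normSq (laplacian φ) ^ 2 := by gcongr
    _ = _ := by ring

/-- The bound of the transport term by the geometric mean of the norms of the transporting field
in `L²` and in `H¹`. -/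
theorem transport_pow_four_le' (hw : ∀ i, IsH1 (w i) (Dw i)) (hw0 : HasZeroMean w)
    (hφ : IsSolenoidal φ) :
    famInner (entries (grad φ)) (tensor (laplacian φ) w) ^ 4
      ≤ 59319 ^ 2 * (l2Sq w * tensorSq Dw * normSq (laplacian φ) ^ 4) := by
  have hN := l2Sq_nonneg w
  have hW := tensorSq_nonneg Dw
  have hL := normSq_nonneg (laplacian φ)
  have h1 := transportSq_sq_le_of_forall (w := w) (φ := φ)
    (Z := 169 ^ 3 * (l2Sq w * tensorSq Dw * normSq (laplacian φ) ^ 2)) fun i j => by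
      refine ((hw j).cellInt_mul_sq_sq_le_right (hw0 j) ((hφ.smooth i).pd j)
        (cellInt_pd (hφ.smooth i) j)).trans ?_
      have e1 : cellInt (fun x => w j x ^ 2) ≤ l2Sq w := normSq_component_le w j
      have e2 := normSq_grad_pd_le hφ.smooth i j
      have e3 := normSq_row_le Dw j
      have e4 := normSq_nonneg (Dw j)
      change _ * (cellInt (fun x => w j x ^ 2) * normSq (Dw j) * _ ^ 2) ≤ _
      have e5 : 0 ≤ ∑ m, cellInt (fun x => pd m (pd j (φ i)) x ^ 2) :=
        Finset.sum_nonneg fun _ _ => cellInt_nonneg fun _ => sq_nonneg _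
      gcongr
  have h2 := transport_sq_le (fun i => (hw i).memL2) hφ
  calc _ = (famInner (entries (grad φ)) (tensor (laplacian φ) w) ^ 2) ^ 2 := by ring
    _ ≤ (3 * transportSq w φ * normSq (laplacian φ)) ^ 2 := pow_le_pow_left₀ (sq_nonneg _) h2 2
    _ = 9 * transportSq w φ ^ 2 * normSq (laplacian φ) ^ 2 := by ring
    _ ≤ 9 * (81 * (169 ^ 3 * (l2Sq w * tensorSq Dw * normSq (laplacian φ) ^ 2)))
        * normSq (laplacian φ) ^ 2 := by gcongr
    _ = _ := by ring

/-- The enstrophy estimate, with the transport term. -/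
theorem enstrophy_le (hν : 0 < ν) (hk : 0 < k) (hg : ∀ i, IsL2 (g i))
    (hw : ∀ i, IsH1 (w i) (Dw i)) (hφ : IsSolenoidal φ)
    (h : eulerForm ν k w φ (grad φ) (laplacian φ)
      = famInner g (laplacian φ) + famInner w (laplacian φ) / k) :
    tensorSq (grad φ) + ν * k * normSq (laplacian φ)
      ≤ tensorSq Dw + 2 * k * |famInner (entries (grad φ)) (tensor (laplacian φ) w)|
        + k / ν * l2Sq g := by
  have h0 : famInner φ (laplacian φ) = - tensorSq (grad φ) := by
    rw [famInner_laplacian (fun i => (hφ.smooth i).isH1) hφ.smooth, ← normSq_entries,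
      ← famInner_self]
    rfl
  rw [eulerForm, h0, famInner_grad_laplacian hφ, famInner_laplacian hw hφ.smooth] at h
  have h1 : 2 * famInner (entries Dw) (entries (grad φ)) ≤ tensorSq Dw + tensorSq (grad φ) := by
    have := normSq_sub (entries Dw) (entries (grad φ)) (isL2_entries hw) hφ.isL2_grad
    have h0 := normSq_nonneg (fun i x => entries Dw i x - entries (grad φ) i x)
    change _ = normSq (entries Dw) - 2 * famInner (entries Dw) (entries (grad φ))
      + normSq (entries (grad φ)) at this
    rw [normSq_entries, normSq_entries] at this
    linarith
  have h2 := le_abs_self (famInner (entries (grad φ)) (tensor (laplacian φ) w))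
  have h3 := (neg_le_abs _).trans (abs_famInner_le hg hφ.laplacian.isL2)
  have h4 : tensorSq (grad φ) + ν * k * normSq (laplacian φ)
      = famInner (entries Dw) (entries (grad φ))
        + k * famInner (entries (grad φ)) (tensor (laplacian φ) w)
        + k * - famInner g (laplacian φ) := by
    field_simp at h
    linarith
  have h5 := Real.sq_sqrt (normSq_nonneg (laplacian φ))
  have h6 := Real.sq_sqrt (normSq_nonneg g)
  change _ ≤ _ + _ + k / ν * normSq g
  set s := √(normSq (laplacian φ))
  set r := √(normSq g)
  rw [← h5] at h4 ⊢
  rw [← h6]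
  have h7 : k / ν * r ^ 2 + ν * k * s ^ 2 - 2 * k * (r * s) = k / ν * (r - ν * s) ^ 2 := by
    field_simp; ring
  have h8 : 0 ≤ k / ν * (r - ν * s) ^ 2 := by positivity
  have h9 := mul_le_mul_of_nonneg_left h2 hk.le
  have h10 := mul_le_mul_of_nonneg_left h3 hk.le
  linarith

end SmoothEstimates

/-! ### Estimates for one step of the scheme -/

section StepEstimates

variable {ν k c₀ : ℝ} {g w u : VField} {Dw Du : TField}

/-- The energy estimate passes to the limit, and Poincaré then turns the dissipation `νk|∇u|²` into
damping. -/
theorem l2Sq_step_le (hν : 0 < ν) (hk : 0 < k) (hc : IsPoincareConstant c₀)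
    (hg : ∀ i, IsL2 (g i)) (hw : ∀ i, IsH1 (w i) (Dw i)) (hw0 : HasZeroMean w)
    (hwdiv : IsDivFree w) (hu : ∀ i, IsH1 (u i) (Du i)) (hu0 : HasZeroMean u)
    (hudiv : IsDivFree u) (hstep : IsEulerStep ν k g w u Du) :
    (1 + ν * k / c₀) * l2Sq u ≤ l2Sq w + k / ν * hMinusOneNorm g ^ 2 := by
  obtain ⟨φ, hφ, h1, -, h3, h4⟩ :=
    exists_smooth_approximation hν hk hg hw hw0 hwdiv hu hu0 hudiv hstep
  have h5 := le_of_tendsto' (h3.add (h4.const_mul (ν * k)))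
    fun S => energy_le hν hk hg (fun i => (hw i).memL2) hwdiv (hφ S) (h1 S)
  have h6 : l2Sq u ≤ c₀ * tensorSq Du := by
    rw [tensorSq, Finset.mul_sum]
    exact Finset.sum_le_sum fun i _ => hc.first _ _ (hu i) (hu0 i)
  have h7 : ν * k / c₀ * l2Sq u ≤ ν * k * tensorSq Du := by
    rw [div_mul_eq_mul_div, div_le_iff₀ hc.pos]
    have := mul_le_mul_of_nonneg_left h6 (mul_pos hν hk).le
    linarith
  change normSq u + _ ≤ normSq w + _ at h5
  change _ * normSq u ≤ normSq w + _
  change _ * normSq u ≤ _ at h7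
  linarith

theorem IsPoincareConstant.tensorSq_grad_le (hc : IsPoincareConstant c₀) {φ : VField}
    (hφ : IsSolenoidal φ) : tensorSq (grad φ) ≤ c₀ * normSq (laplacian φ) := by
  rw [tensorSq, normSq, Finset.mul_sum]
  exact Finset.sum_le_sum fun i _ => hc.second (φ i) (grad φ i) (fun j m => pd m (pd j (φ i)))
    (hφ.smooth i).isH1 (hφ.mean i) fun j => ((hφ.smooth i).pd j).isH1

/-- Smallness of the drift lets half of the dissipation absorb the transport term; the second-order
Poincaré inequality turns the other half into the damping `νk/(2c₀)`. -/
theorem tensorSq_step_le_of_small (hν : 0 < ν) (hk : 0 < k) (hc : IsPoincareConstant c₀)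
    (hg : ∀ i, IsL2 (g i)) (hw : ∀ i, IsH1 (w i) (Dw i)) (hw0 : HasZeroMean w)
    (hwdiv : IsDivFree w) (hu : ∀ i, IsH1 (u i) (Du i)) (hu0 : HasZeroMean u)
    (hudiv : IsDivFree u) (hstep : IsEulerStep ν k g w u Du)
    (hsmall : l2Sq w * tensorSq Dw ≤ 1 / (4 ^ 4 * 59319 ^ 2) * ν ^ 4) :
    (1 + ν * k / (2 * c₀)) * tensorSq Du ≤ tensorSq Dw + k / ν * l2Sq g := by
  obtain ⟨φ, hφ, -, h2, -, h4⟩ :=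
    exists_smooth_approximation hν hk hg hw hw0 hwdiv hu hu0 hudiv hstep
  refine le_of_tendsto' (h4.const_mul _) fun S => ?_
  have h5 := enstrophy_le hν hk hg hw (hφ S) (h2 S)
  have h6 := transport_pow_four_le' hw hw0 (hφ S)
  have hL := normSq_nonneg (laplacian (φ S))
  have hD := hc.tensorSq_grad_le (hφ S)
  set T := famInner (entries (grad (φ S))) (tensor (laplacian (φ S)) w)
  set Λ := normSq (laplacian (φ S))
  -- The smallness constant is tuned so that the bound of `T⁴` becomes exactly `(νΛ/4)⁴`.
  have h7 : |T| ≤ ν * Λ / 4 := by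
    refine le_of_pow_le_pow_left₀ four_ne_zero (by positivity) ?_
    rw [Even.pow_abs (by decide)]
    calc T ^ 4 ≤ _ := h6
      _ ≤ 59319 ^ 2 * (1 / (4 ^ 4 * 59319 ^ 2) * ν ^ 4 * Λ ^ 4) := by gcongr
      _ = _ := by ring
  have h8 : ν * k / (2 * c₀) * tensorSq (grad (φ S)) ≤ ν * k * Λ / 2 := by
    have hc0 := hc.pos
    rw [div_mul_eq_mul_div, div_le_iff₀ (by positivity)]
    have := mul_le_mul_of_nonneg_left hD (mul_pos hν hk).le
    linarith
  have h9 := mul_le_mul_of_nonneg_left h7 hk.le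
  linarith

theorem tensorSq_step_le (hν : 0 < ν) (hk : 0 < k)
    (hg : ∀ i, IsL2 (g i)) (hw : ∀ i, IsH1 (w i) (Dw i)) (hw0 : HasZeroMean w)
    (hwdiv : IsDivFree w) (hu : ∀ i, IsH1 (u i) (Du i)) (hu0 : HasZeroMean u)
    (hudiv : IsDivFree u) (hstep : IsEulerStep ν k g w u Du) :
    tensorSq Du ≤ tensorSq Dw + k * (4 * 59319 ^ 2 / ν ^ 3 * tensorSq Dw ^ 2 * tensorSq Du)
      + k / ν * l2Sq g := by
  obtain ⟨φ, hφ, -, h2, -, h4⟩ :=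
    exists_smooth_approximation hν hk hg hw hw0 hwdiv hu hu0 hudiv hstep
  refine le_of_tendsto_of_tendsto' h4
    ((((h4.const_mul _).const_mul k).const_add _).add_const _) fun S => ?_
  have h5 := enstrophy_le hν hk hg hw (hφ S) (h2 S)
  have h6 := transport_pow_four_le hw hw0 (hφ S)
  have hL := normSq_nonneg (laplacian (φ S))
  have hD := tensorSq_nonneg (grad (φ S))
  have hW := tensorSq_nonneg Dw
  set T := famInner (entries (grad (φ S))) (tensor (laplacian (φ S)) w)
  set Λ := normSq (laplacian (φ S))
  set D := tensorSq (grad (φ S))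
  -- Young's inequality without roots: `z` is chosen so that the single term `4(νΛ)³z` of `(νΛ +
  -- z)⁴` equals `2⁴` times the bound of `T⁴`. This fixes `c₄`; the whole remaining dissipation is
  -- spent.
  set z := 4 * 59319 ^ 2 / ν ^ 3 * tensorSq Dw ^ 2 * D with hz
  have hz0 : 0 ≤ z := by positivity
  have h7 : 2 * |T| ≤ ν * Λ + z := by
    refine le_of_pow_le_pow_left₀ four_ne_zero (by positivity) ?_
    rw [mul_pow, Even.pow_abs (by decide)]
    have h8 : 4 * (ν * Λ) ^ 3 * z = 2 ^ 4 * (59319 ^ 2 * (D * tensorSq Dw ^ 2 * Λ ^ 3)) := by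
      rw [hz]; field_simp; ring
    have h9 : (ν * Λ + z) ^ 4 = (ν * Λ) ^ 4 + 4 * (ν * Λ) ^ 3 * z + 6 * (ν * Λ) ^ 2 * z ^ 2
      + 4 * (ν * Λ) * z ^ 3 + z ^ 4 := by ring
    have h10 : 0 ≤ (ν * Λ) ^ 4 + 6 * (ν * Λ) ^ 2 * z ^ 2 + 4 * (ν * Λ) * z ^ 3 + z ^ 4 := by
      positivity
    linarith
  have h11 := mul_le_mul_of_nonneg_left h7 hk.le
  linarith

end StepEstimates

/-! ### Discrete Gronwall inequalities -/

section Recurrences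

/-- Since `b ≤ δK`, the right-hand side is at most `(1 + δ)K`. -/
theorem le_of_damped_step {δ b x y K : ℝ} (hδ : 0 < δ) (hK : b / δ ≤ K)
    (h : (1 + δ) * y ≤ x + b) (hx : x ≤ K) : y ≤ K := by
  rw [div_le_iff₀ hδ] at hK
  refine le_of_mul_le_mul_left ?_ (show 0 < 1 + δ by linarith)
  linarith

/-- A discrete nonlinear Gronwall inequality. -/
theorem le_of_quadratic_recurrence {a F : ℝ} (ha : 0 ≤ a) (hF : 0 ≤ F) {x : ℕ → ℝ}
    (hx : ∀ n, 0 ≤ x n) (hrec : ∀ n, x (n + 1) ≤ x n + a * x n ^ 2 * x (n + 1) + a * F ^ 3)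
    (hs : a * (2 * x 0 + F) ^ 2 ≤ 1 / 2) (n : ℕ) (hn : n * (a * (8 * (x 0 + F) ^ 2)) ≤ 1) :
    x n ≤ 2 * x 0 + F := by
  have hx0 := hx 0
  set M := 2 * x 0 + F with hM
  set s := a * M ^ 2 with hsdef
  have hM0 : 0 ≤ M := by positivity
  have hs0 : 0 ≤ s := by positivity
  -- From `M² ≤ 4(x₀ + F)²` and the factor 8 in the time restriction, `ms ≤ 1/2`, so Bernoulli gives
  -- `(1 - s)^m ≥ 1/2`. The same restriction gives `m a F³ ≤ F/8`, hence `x m ≤ 2x₀ + F/4 ≤ M`.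
  have key : ∀ m : ℕ, m * (a * (8 * (x 0 + F) ^ 2)) ≤ 1 →
      (1 - s) ^ m * x m ≤ x 0 + m * (a * F ^ 3) → x m ≤ M := fun m hm h => by
    have h1 : 1 / 2 ≤ (1 - s) ^ m := by
      have h2 := one_add_mul_le_pow (show -2 ≤ -s by linarith) m
      have h3 : s ≤ a * (8 * (x 0 + F) ^ 2) / 2 := by
        have : M ^ 2 ≤ 4 * (x 0 + F) ^ 2 := by rw [hM]; nlinarith
        have := mul_le_mul_of_nonneg_left this ha
        linarith
      have h4 := mul_le_mul_of_nonneg_left h3 (Nat.cast_nonneg (α := ℝ) m)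
      rw [← sub_eq_add_neg] at h2
      linarith
    have h5 : m * (a * F ^ 3) ≤ F / 8 := by
      have h6 : 8 * F ^ 2 ≤ 8 * (x 0 + F) ^ 2 := by gcongr; linarith
      have h7 : m * (a * (8 * F ^ 2)) ≤ 1 :=
        (mul_le_mul_of_nonneg_left (mul_le_mul_of_nonneg_left h6 ha) (Nat.cast_nonneg m)).trans hm
      have h8 := mul_le_mul_of_nonneg_right h7 hF
      linarith
    have h9 := mul_le_mul_of_nonneg_right h1 (hx m)
    linarith
  -- The bootstrap is explicit: passing from `m` to `m + 1` uses `x m ≤ M` only at the earlier time,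
  -- because the quadratic factor of the recurrence is lagged.
  have main : ∀ m : ℕ, m * (a * (8 * (x 0 + F) ^ 2)) ≤ 1 →
      (1 - s) ^ m * x m ≤ x 0 + m * (a * F ^ 3) := by
    intro m
    induction m with
    | zero => intro _; simp
    | succ m ih =>
      intro hm
      have hq : 0 ≤ a * (8 * (x 0 + F) ^ 2) := by positivity
      push_cast at hm ⊢
      have hm' : m * (a * (8 * (x 0 + F) ^ 2)) ≤ 1 := by linarith
      have h1 := ih hm'
      have h2 := key m hm' h1
      have h3 : a * x m ^ 2 * x (m + 1) ≤ s * x (m + 1) :=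
        mul_le_mul_of_nonneg_right (mul_le_mul_of_nonneg_left (pow_le_pow_left₀ (hx m) h2 2) ha)
          (hx _)
      have h4 : (1 - s) * x (m + 1) ≤ x m + a * F ^ 3 := by linarith [hrec m]
      have h5 : 0 ≤ (1 - s) ^ m := pow_nonneg (by linarith) m
      have h6 : (1 - s) ^ m ≤ 1 := pow_le_one₀ (by linarith) (by linarith)
      have h7 := mul_le_mul_of_nonneg_left h4 h5
      have h8 : (1 - s) ^ m * (a * F ^ 3) ≤ a * F ^ 3 := mul_le_of_le_one_left (by positivity) h6
      have h9 : (1 - s) ^ (m + 1) * x (m + 1) = (1 - s) ^ m * ((1 - s) * x (m + 1)) := by ring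
      linarith
  exact key n hn (main n hn)

end Recurrences

/-! ### Bounds for solutions of the scheme -/

section Solutions

variable {ν k c₀ : ℝ} {f : ℝ → VField} {u : ℕ → VField} {Du : ℕ → TField}

theorem IsForcing.l2Sq_le (hf : IsForcing f) {t : ℝ} (ht : 0 ≤ t) : l2Sq (f t) ≤ supL2 f ^ 2 := by
  have h : √(l2Sq (f t)) ≤ supL2 f := le_ciSup hf.bounded (⟨t, ht⟩ : Ici (0 : ℝ))
  rw [← Real.sq_sqrt (l2Sq_nonneg (f t))]
  exact pow_le_pow_left₀ (Real.sqrt_nonneg _) h 2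

theorem IsForcing.hMinusOneNorm_sq_le (hf : IsForcing f) {t : ℝ} (ht : 0 ≤ t) :
    hMinusOneNorm (f t) ^ 2 ≤ supHMinusOne f ^ 2 := by
  refine pow_le_pow_left₀ (hMinusOneNorm_nonneg (hf.memL2 t ht)) ?_ 2
  obtain ⟨M, hM⟩ := hf.bounded
  have hb : BddAbove (Set.range fun t : Ici (0 : ℝ) => hMinusOneNorm (f t)) := by
    refine ⟨M, ?_⟩
    rintro _ ⟨t, rfl⟩
    exact (hMinusOneNorm_le (hf.memL2 t t.2)).trans (hM ⟨t, rfl⟩)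
  exact le_ciSup hb (⟨t, ht⟩ : Ici (0 : ℝ))

theorem IsSemiImplicitSolution.hasZeroMean (hk : 0 < k) (hf : IsForcing f)
    (h : IsSemiImplicitSolution ν k f u Du) (n : ℕ) : HasZeroMean (u n) := by
  induction n with
  | zero => exact h.zeroMean_init
  | succ n ih =>
    exact (h.step n).hasZeroMean hk (hf.zeroMean _ (by positivity)) (h.memH1 n) ih (h.divFree n)
      (h.memH1 (n + 1))

theorem IsSemiImplicitSolution.l2Sq_le (hν : 0 < ν) (hk : 0 < k) (hc : IsPoincareConstant c₀)
    (hf : IsForcing f) (h : IsSemiImplicitSolution ν k f u Du) (n : ℕ) :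
    l2Sq (u n) ≤ K0 c₀ ν (u 0) f := by
  have hc0 := hc.pos
  induction n with
  | zero => exact le_add_of_nonneg_right (by positivity)
  | succ n ih =>
    have ht : 0 ≤ ((n + 1 : ℕ) : ℝ) * k := by positivity
    have h1 := l2Sq_step_le hν hk hc (hf.memL2 _ ht) (h.memH1 n) (h.hasZeroMean hk hf n)
      (h.divFree n) (h.memH1 (n + 1)) (h.hasZeroMean hk hf (n + 1)) (h.divFree (n + 1)) (h.step n)
    have h2 := mul_le_mul_of_nonneg_left (hf.hMinusOneNorm_sq_le ht) (div_pos hk hν).le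
    refine le_of_damped_step (δ := ν * k / c₀) (b := k / ν * supHMinusOne f ^ 2) (by positivity) ?_
      (h1.trans (by linarith)) ih
    have h3 : k / ν * supHMinusOne f ^ 2 / (ν * k / c₀) = c₀ / ν ^ 2 * supHMinusOne f ^ 2 := by
      field_simp
    rw [h3, K0]
    exact le_add_of_nonneg_left (l2Sq_nonneg _)

theorem IsSemiImplicitSolution.tensorSq_le_of_small (hν : 0 < ν) (hk : 0 < k)
    (hc : IsPoincareConstant c₀) (hf : IsForcing f) (h : IsSemiImplicitSolution ν k f u Du)
    (hsmall : K0 c₀ ν (u 0) f * K1 c₀ ν (Du 0) f ≤ 1 / (4 ^ 4 * 59319 ^ 2) * ν ^ 4) (n : ℕ) :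
    tensorSq (Du n) ≤ K1 c₀ ν (Du 0) f := by
  have hc0 := hc.pos
  induction n with
  | zero => exact le_add_of_nonneg_right (by positivity)
  | succ n ih =>
    have ht : 0 ≤ ((n + 1 : ℕ) : ℝ) * k := by positivity
    have h0 := h.l2Sq_le hν hk hc hf n
    have h1 := tensorSq_step_le_of_small hν hk hc (hf.memL2 _ ht) (h.memH1 n)
      (h.hasZeroMean hk hf n) (h.divFree n) (h.memH1 (n + 1)) (h.hasZeroMean hk hf (n + 1))
      (h.divFree (n + 1)) (h.step n)
      -- The drift is small enough by the energy bound `K0` and the induction hypothesis `K1`, so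
      -- the smallness is reproduced at every step.
      ((mul_le_mul h0 ih (tensorSq_nonneg _) ((l2Sq_nonneg _).trans h0)).trans hsmall)
    have h2 := mul_le_mul_of_nonneg_left (hf.l2Sq_le ht) (div_pos hk hν).le
    refine le_of_damped_step (δ := ν * k / (2 * c₀)) (b := k / ν * supL2 f ^ 2) (by positivity) ?_
      (h1.trans (by linarith)) ih
    have h3 : k / ν * supL2 f ^ 2 / (ν * k / (2 * c₀)) = 2 * c₀ / ν ^ 2 * supL2 f ^ 2 := by
      field_simp
    rw [h3, K1]
    exact le_add_of_nonneg_left (tensorSq_nonneg _)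

theorem Fconst_nonneg {c₄ : ℝ} (hc₄ : 0 < c₄) : 0 ≤ Fconst c₄ ν f :=
  Real.rpow_nonneg (by positivity) _

theorem Fconst_pow_three {c₄ : ℝ} (hc₄ : 0 < c₄) :
    Fconst c₄ ν f ^ 3 = ν ^ 2 * supL2 f ^ 2 / c₄ := by
  rw [Fconst, ← Real.rpow_natCast, ← Real.rpow_mul (by positivity)]
  norm_num

theorem IsSemiImplicitSolution.tensorSq_le_of_short (hν : 0 < ν) (hk : 0 < k)
    (hf : IsForcing f) (h : IsSemiImplicitSolution ν k f u Du) {c₄ : ℝ}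
    (hc₄ : c₄ = 4 * 59319 ^ 2)
    (hstep : k * (2 * c₄ * (2 * tensorSq (Du 0) + Fconst c₄ ν f) ^ 2) ≤ ν ^ 3) (n : ℕ)
    (hn : (n : ℝ) * k * (8 * c₄ * (tensorSq (Du 0) + Fconst c₄ ν f) ^ 2) ≤ ν ^ 3) :
    tensorSq (Du n) ≤ 2 * tensorSq (Du 0) + Fconst c₄ ν f := by
  have hc0 : 0 < c₄ := by rw [hc₄]; norm_num
  have hν3 : 0 < ν ^ 3 := by positivity
  refine le_of_quadratic_recurrence (a := c₄ * k / ν ^ 3) (x := fun n => tensorSq (Du n))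
    (by positivity) (Fconst_nonneg hc0) (fun _ => tensorSq_nonneg _) (fun m => ?_) ?_ n ?_
  · have ht : 0 ≤ ((m + 1 : ℕ) : ℝ) * k := by positivity
    have h1 := tensorSq_step_le hν hk (hf.memL2 _ ht) (h.memH1 m)
      (h.hasZeroMean hk hf m) (h.divFree m) (h.memH1 (m + 1)) (h.hasZeroMean hk hf (m + 1))
      (h.divFree (m + 1)) (h.step m)
    have h2 := mul_le_mul_of_nonneg_left (hf.l2Sq_le ht) (div_pos hk hν).le
    -- `F` is designed so that the forcing term is `a F³` with the same `a = c₄k/ν³` as in the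
    -- quadratic term.
    have h3 : c₄ * k / ν ^ 3 * Fconst c₄ ν f ^ 3 = k / ν * supL2 f ^ 2 := by
      rw [Fconst_pow_three hc0]; field_simp
    have h4 : c₄ * k / ν ^ 3 * tensorSq (Du m) ^ 2 * tensorSq (Du (m + 1))
        = k * (4 * 59319 ^ 2 / ν ^ 3 * tensorSq (Du m) ^ 2 * tensorSq (Du (m + 1))) := by
      rw [hc₄]; ring
    rw [h3, h4]
    linarith
  · rw [div_mul_eq_mul_div, div_le_iff₀ hν3]
    linarith
  · rw [div_mul_eq_mul_div, mul_div_assoc', div_le_iff₀ hν3]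
    linarith

end Solutions

end PeriodicNS

theorem theorem1 :
    (∃ c₀ : ℝ, IsPoincareConstant c₀) ∧
    ∃ c₂ : ℝ, 0 < c₂ ∧ ∃ c₄ : ℝ, 0 < c₄ ∧
      ∀ c₀ : ℝ, IsPoincareConstant c₀ →
      ∀ (ν k : ℝ), 0 < ν → 0 < k →
      ∀ (f : ℝ → VField) (u : ℕ → VField) (Du : ℕ → TField),
        IsForcing f → IsSemiImplicitSolution ν k f u Du →
        -- small data
        ((K0 c₀ ν (u 0) f + k * supHMinusOne f ^ 2 / ν)
              * (K1 c₀ ν (Du 0) f + 2 * k * supL2 f ^ 2 / ν) ≤ c₂ * ν ^ 4 →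
          ∀ n : ℕ, tensorSq (Du n) ≤ K1 c₀ ν (Du 0) f + 2 * k / ν * supL2 f ^ 2) ∧
        -- short times; both bounds on times are cleared of their denominators
        (k * (2 * c₄ * (2 * tensorSq (Du 0) + Fconst c₄ ν f) ^ 2) ≤ ν ^ 3 →
          ∀ n : ℕ, (n : ℝ) * k * (8 * c₄ * (tensorSq (Du 0) + Fconst c₄ ν f) ^ 2) ≤ ν ^ 3 →
            tensorSq (Du n) ≤ 2 * tensorSq (Du 0) + Fconst c₄ ν f) := by
  -- `c₂` and `c₄` do not depend on `c₀`, because the product estimates behind 59319 use Poincaré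
  -- with constant 1; a general `c₀` enters only through the damping.
  refine ⟨⟨1, isPoincareConstant_one⟩, 1 / (4 ^ 4 * 59319 ^ 2), by norm_num, 4 * 59319 ^ 2,
    by norm_num, fun c₀ hc ν k hν hk f u Du hf h => ⟨fun hsmall n => ?_, fun hstep n hn =>
      h.tensorSq_le_of_short hν hk hf rfl hstep n hn⟩⟩
  have hc0 := hc.pos
  have hK0 : 0 ≤ K0 c₀ ν (u 0) f := add_nonneg (l2Sq_nonneg _) (by positivity)
  have hK1 : 0 ≤ K1 c₀ ν (Du 0) f := add_nonneg (tensorSq_nonneg _) (by positivity)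
  -- The induction works with `K0` and `K1` alone; the additional terms with `k` strengthen the
  -- smallness condition and weaken the bound.
  refine (h.tensorSq_le_of_small hν hk hc hf (le_trans ?_ hsmall) n).trans
    (le_add_of_nonneg_right (by positivity))
  exact mul_le_mul (le_add_of_nonneg_right (by positivity))
    (le_add_of_nonneg_right (by positivity)) hK1 (add_nonneg hK0 (by positivity))
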